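/- **Notation.** A sign vector on a finite set $E$ is an element $X\in\{-,0,+\}^E$, with $X^{\pm}=\{e: X_e=\pm\}$ and support $\underline X=X^+\cup X^-$; signs are multiplied and ordered as the numbers $-1<0<1$. The composition $X\circ Y$ has $(X\circ Y)_e=X_e$ if $X_e\neq0$ and $(X\circ Y)_e=Y_e$ otherwise. An oriented matroid $\mathcal M=(E,\mathcal V)$ is given by a set $\mathcal V$ of sign vectors on $E$ (its vectors) such that $0\in\mathcal V$; $-X\in\mathcal V$ and $X\circ Y\in\mathcal V$ for all $X,Y\in\mathcal V$; and for all $X,Y\in\mathcal V$ and $e\in X^+\cap Y^-$ there is $Z\in\mathcal V$ with $Z^+\subseteq X^+\cup Y^+$, $Z^-\subseteq X^-\cup Y^-$, $Z_e=0$ and $(\underline X\setminus\underline Y)\cup(\underline Y\setminus\underline X)\cup(X^+\cap Y^+)\cup(X^-\cap Y^-)\subseteq\underline Z$. A circuit is a nonzero vector $C$ such that no nonzero vector has support strictly contained in $\underline C$. A basis is an inclusion-maximal subset of $E$ that contains the support of no circuit. Sign vectors $X,Y$ are orthogonal if the products $X_eY_e$, $e\in E$, are all $0$ or include both $+$ and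 $-$. The covectors of $\mathcal M$ are the sign vectors orthogonal to every vector of $\mathcal M$ (that is, the vectors of the dual $\mathcal M^*$), and the cocircuits are the nonzero covectors $D$ such that no nonzero covector has support strictly contained in $\underline D$. Let $E_{2n}$ be a set partitioned into two $n$-element sets $S$ and $T$, with an involution $e\mapsto\overline e$ of $E_{2n}$ mapping $S$ to $T$. A sign vector $X$ on $E_{2n}$ is sign-reversing if $X_eX_{\overline e}\le0$ for all $e\in S$, and sign-preserving if $X_eX_{\overline e}\ge0$ for all $e\in E_{2n}$; it is totally sign-reversing, respectively totally sign-preserving, if moreover $\underline X=E_{2n}$. Let $\hat E_{2n}=E_{2n}\cup\{q\}$ with $q\notin E_{2n}$. A one-point extension of $\mathcal M=(E_{2n},\mathcal V)$ is an oriented matroid $\hat{\mathcal M}=(\hat E_{2n},\hat{\mathcal V})$ such that $\mathcal V$ is the set of restrictions to $E_{2n}$ of those $X\in\hat{\mathcal V}$ with $X_q=0$, and such that some $X\in\hat{\mathcal V}$ has $X_q\neq0$. A sign vector $X$ on $\hat E_{2n}$ is complementary if $X_eX_{\overline e}=0$ for all $e\in E_{2n}$. **Theorem 3.3.** Let $\mathcal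 M$ be an oriented matroid on $E_{2n}$ such that $S$ is a basis of $\mathcal M$. The following conditions are equivalent: - (a) $\mathcal M$ has no sign-reversing circuit; - (a\*) $\mathcal M$ has no sign-preserving cocircuit; - (b) every totally sign-preserving sign vector $X$ on $E_{2n}$ is a vector of $\mathcal M$; - (b\*) every totally sign-reversing sign vector $Y$ on $E_{2n}$ is a covector of $\mathcal M$; - (c) every one-point extension $\hat{\mathcal M}$ of $\mathcal M$ to $\hat E_{2n}$ has exactly one complementary circuit $C$ such that $C\ge0$ and $C_q=+$. -/

import Mathlib

/-- The composition `X ∘ Y` of sign vectors: `X e` where this is nonzero, and `Y e` elsewhere. -/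
def signComp {E : Type*} (X Y : E → SignType) : E → SignType :=
  fun e => if X e ≠ 0 then X e else Y e

/-- An oriented matroid on `E`, given by its set of vectors, with the vector axioms.
The last axiom is vector elimination: `X⁺ = {f | X f = 1}`, `X⁻ = {f | X f = -1}`, and the
support of `X` is `{f | X f ≠ 0}`. -/
structure OrientedMatroid (E : Type*) where
  vectors : Set (E → SignType)
  zero_mem : (0 : E → SignType) ∈ vectors
  neg_mem : ∀ X ∈ vectors, -X ∈ vectors
  comp_mem : ∀ X ∈ vectors, ∀ Y ∈ vectors, signComp X Y ∈ vectors
  elimination : ∀ X ∈ vectors, ∀ Y ∈ vectors, ∀ e : E, X e = 1 → Y e = -1 →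
    ∃ Z ∈ vectors,
      (∀ f, Z f = 1 → X f = 1 ∨ Y f = 1) ∧
      (∀ f, Z f = -1 → X f = -1 ∨ Y f = -1) ∧
      Z e = 0 ∧
      (∀ f, (X f ≠ 0 ∧ Y f = 0) ∨ (Y f ≠ 0 ∧ X f = 0) ∨
        (X f = 1 ∧ Y f = 1) ∨ (X f = -1 ∧ Y f = -1) → Z f ≠ 0)

/-- `C` is a nonzero element of the set `V` of sign vectors, and no nonzero element of `V` has
a strictly smaller support. -/
def IsMinimalNonzero {E : Type*} (V : Set (E → SignType)) (C : E → SignType) : Prop :=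
  C ∈ V ∧ C ≠ 0 ∧ ¬ ∃ X ∈ V, X ≠ 0 ∧ Function.support X ⊂ Function.support C

/-- Orthogonality of sign vectors: all products `X e * Y e` vanish, or both signs occur. -/
def SignOrthogonal {E : Type*} (X Y : E → SignType) : Prop :=
  (∀ e, X e * Y e = 0) ∨ ((∃ e, X e * Y e = 1) ∧ ∃ e, X e * Y e = -1)

namespace OrientedMatroid

variable {E : Type*}

/-- Circuits: the nonzero vectors of minimal support. -/
def IsCircuit (M : OrientedMatroid E) (C : E → SignType) : Prop :=
  IsMinimalNonzero M.vectors C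

/-- The vectors of the dual: the sign vectors that are orthogonal to every vector. -/
def covectors (M : OrientedMatroid E) : Set (E → SignType) :=
  {Y | ∀ X ∈ M.vectors, SignOrthogonal X Y}

/-- Cocircuits: the circuits of the dual. -/
def IsCocircuit (M : OrientedMatroid E) (D : E → SignType) : Prop :=
  IsMinimalNonzero M.covectors D

/-- A basis: an inclusion-maximal set that does not contain the support of a circuit. -/
def IsBasis (M : OrientedMatroid E) (B : Set E) : Prop :=
  Maximal (fun I : Set E => ¬ ∃ C, M.IsCircuit C ∧ Function.support C ⊆ I) B

/-- `Mhat`, on the ground set `E ∪ {q}` with `q = none`, is a one-point extension of `M`: the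
deletion of `q` is `M`, and `q` is in the support of some vector. -/
def IsOnePointExtension (M : OrientedMatroid E) (Mhat : OrientedMatroid (Option E)) : Prop :=
  {Y : E → SignType | ∃ X ∈ Mhat.vectors, X none = 0 ∧ Y = fun e => X (some e)} = M.vectors ∧
    ∃ X ∈ Mhat.vectors, X none ≠ 0

end OrientedMatroid

/-- The structure of a ground set `E` with `2 n` elements: a partition into `S` and `T` with `n`
elements each, and an involution `bar` that maps `S` to `T`. -/
structure Complementation (E : Type*) (n : ℕ) where
  S : Set E
  T : Set E
  isCompl : IsCompl S T
  encard_S : S.encard = n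
  encard_T : T.encard = n
  bar : E → E
  bar_bar : ∀ e, bar (bar e) = e
  bar_mem : ∀ e ∈ S, bar e ∈ T

namespace Complementation

variable {E : Type*} {n : ℕ}

/-- Sign-reversing sign vectors. -/
def SignReversing (K : Complementation E n) (X : E → SignType) : Prop :=
  ∀ e ∈ K.S, X e * X (K.bar e) ≤ 0

/-- Totally sign-reversing sign vectors. -/
def TotallySignReversing (K : Complementation E n) (X : E → SignType) : Prop :=
  K.SignReversing X ∧ Function.support X = Set.univ

/-- Sign-preserving sign vectors. -/
def SignPreserving (K : Complementation E n) (X : E → SignType) : Prop :=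
  ∀ e, 0 ≤ X e * X (K.bar e)

/-- Totally sign-preserving sign vectors. -/
def TotallySignPreserving (K : Complementation E n) (X : E → SignType) : Prop :=
  K.SignPreserving X ∧ Function.support X = Set.univ

/-- Complementary sign vectors on `E ∪ {q}`: no element of `E` lies in the support together with
its complement. -/
def IsComplementary (K : Complementation E n) (X : Option E → SignType) : Prop :=
  ∀ e : E, X (some e) * X (some (K.bar e)) = 0

end Complementation

/-! Circuits can be replaced by nonzero vectors: each nonzero vector has a circuit conforming to it
(`exists_circuit_conforms`), and being sign-reversing or sign-preserving passes to conforming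
vectors. For `Y` of full support, a vector has nonnegative products with `Y` exactly when it
conforms to `Y`; so `Y` is a covector iff no nonzero vector conforms to it. As every sign-reversing
vector extends to a totally sign-reversing one, (a) ⇔ (b*) follows, and (a*) ⇔ (b) is the same
argument in the dual.

The link between (a) and (a*) is `PairCondition`. For a transversal `A` of the pairs and `e ∈ A`, it
fixes the sign on `e, bar e` of a vector supported in `A ∪ {bar e}` and of a covector supported in
`Aᶜ ∪ {e}`; complementing `A` exchanges the two, so the condition is self-dual up to the sign `ε`.
Under (a) it holds by basis exchange from `S`: a fundamental vector contains at most one full pair,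
which therefore cannot be reversed or incomplete. Conversely, eliminating with fundamental vectors
removes full pairs from a sign-reversing vector until its support lies in a transversal, where a
fundamental covector meets it in one element (`PairCondition.eq_zero`).

For (a) ⇒ (c), two competing solutions give, after elimination of `q`, a nonzero sign-reversing
vector of `M`. This proves uniqueness, and also existence by making the pairs nonnegative one at a
time. For (c) ⇒ (a), `PairCondition` is read off from two lexicographic extensions: `q` is placed
opposite to `A \ {e}`, and then perturbed towards `e`. Uniqueness before the perturbation forces the
solution after it to be positive on `A \ {e}`; with a wrong sign at `e`, this contradicts
orthogonality to the fundamental covector at `e`. -/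

/-! ### Sign vectors -/

/-- `U` conforms to `Y`: it agrees with `Y` on its support. -/
def Conforms {E : Type*} (U Y : E → SignType) : Prop :=
  ∀ f, U f ≠ 0 → U f = Y f

section SignVectors

variable {E : Type*} {X Y Z U : E → SignType}

theorem Conforms.refl (X : E → SignType) : Conforms X X := fun _ _ => rfl

theorem Conforms.trans (h : Conforms X Y) (h' : Conforms Y Z) : Conforms X Z := by
  intro f hf
  have h1 := h f hf
  rw [h1]
  exact h' f (h1 ▸ hf)

theorem Conforms.neg (h : Conforms X Y) : Conforms (-X) (-Y) := by
  intro f hf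
  have : X f ≠ 0 := by
    intro h0; apply hf; simp [h0]
  simp [h f this]

theorem Conforms.eq_zero (h : Conforms X Y) {f : E} (hf : Y f = 0) : X f = 0 := by
  by_contra hne
  exact hne ((h f hne).trans hf)

theorem signComp_apply (X Y : E → SignType) (f : E) :
    signComp X Y f = if X f ≠ 0 then X f else Y f := rfl

theorem signComp_of_ne {f : E} (h : X f ≠ 0) : signComp X Y f = X f := by
  simp [signComp, h]

theorem signComp_of_eq {f : E} (h : X f = 0) : signComp X Y f = Y f := by
  simp [signComp, h]

theorem conforms_signComp_left (X Y : E → SignType) : Conforms X (signComp X Y) :=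
  fun _ hf => (signComp_of_ne hf).symm

theorem Conforms.signComp_right (h : Conforms U Y) (X : E → SignType) :
    Conforms (signComp X U) (signComp X Y) := by
  intro f hf
  by_cases h0 : X f = 0
  · rw [signComp_of_eq h0] at hf ⊢
    rw [signComp_of_eq h0]
    exact h f hf
  · rw [signComp_of_ne h0, signComp_of_ne h0]

theorem Conforms.signComp (hX : Conforms X Z) (hY : Conforms Y Z) :
    Conforms (signComp X Y) Z := by
  intro f hf
  by_cases h0 : X f = 0
  · rw [signComp_of_eq h0] at hf ⊢
    exact hY f hf
  · rw [signComp_of_ne h0]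
    exact hX f h0

theorem SignOrthogonal.symm (h : SignOrthogonal X Y) : SignOrthogonal Y X := by
  simpa only [SignOrthogonal, mul_comm] using h

theorem SignOrthogonal.eq_zero_of_nonneg (h : SignOrthogonal X Y) (h0 : ∀ e, 0 ≤ X e * Y e)
    (e : E) : X e * Y e = 0 := by
  rcases h with h | ⟨-, f, hf⟩
  · exact h e
  · have := h0 f
    rw [hf] at this
    exact absurd this (by decide)

theorem SignOrthogonal.neg_right (h : SignOrthogonal X Y) : SignOrthogonal X (-Y) := by
  rcases h with h | ⟨⟨e, he⟩, f, hf⟩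
  · left; intro e; simp [h e]
  · exact Or.inr ⟨⟨f, by simp [hf]⟩, e, by simp [he]⟩

theorem SignOrthogonal.zero_right (X : E → SignType) : SignOrthogonal X 0 :=
  Or.inl fun e => by simp

theorem SignType.ne_zero_cases {a : SignType} (h : a ≠ 0) : a = 1 ∨ a = -1 := by
  revert a; decide

/-- To be orthogonal to a symmetric set it suffices not to have a nonzero nonnegative product. -/
theorem signOrthogonal_of_nonneg {W : Set (E → SignType)} (hneg : ∀ Y ∈ W, -Y ∈ W)
    (h : ∀ Y ∈ W, (∀ e, 0 ≤ X e * Y e) → ∀ e, X e * Y e = 0) :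
    ∀ Y ∈ W, SignOrthogonal X Y := by
  intro Y hY
  by_contra hno
  simp only [SignOrthogonal, not_or, not_and_or, not_forall, not_exists] at hno
  obtain ⟨⟨e, he⟩, h1 | h1⟩ := hno
  · have := h _ (hneg Y hY) (fun f => by
      have := h1 f
      simp only [Pi.neg_apply]
      generalize X f = a, Y f = b at *
      revert a b; decide) e
    apply he
    simp only [Pi.neg_apply] at this
    generalize X e = a, Y e = b at *
    revert a b; decide
  · exact he (h Y hY (fun f => by
      have := h1 f
      generalize X f = a, Y f = b at *
      revert a b; decide) e)

theorem SignOrthogonal.signComp_right (h1 : SignOrthogonal X Y) (h2 : SignOrthogonal X Z) :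
    SignOrthogonal X (signComp Y Z) := by
  rcases h1 with h | ⟨⟨e, he⟩, f, hf⟩
  · have key : ∀ e, X e * signComp Y Z e = X e * Z e := by
      intro e
      have := h e
      by_cases h0 : Y e = 0
      · rw [signComp_of_eq h0]
      · have : X e = 0 := by
          generalize X e = a, Y e = b at *
          revert a b; decide
        simp [this]
    simpa only [SignOrthogonal, key] using h2
  · refine Or.inr ⟨⟨e, ?_⟩, f, ?_⟩
    · rwa [signComp_of_ne]
      intro h0; simp [h0] at he
    · rwa [signComp_of_ne]
      intro h0; simp [h0] at hf

end SignVectors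

/-! ### Elimination, orthogonal extension and the Farkas lemma -/

namespace OrientedMatroid

variable {E : Type*} (M : OrientedMatroid E)

/-- Vector elimination at a separated element. -/
theorem exists_elim {X Y : E → SignType} (hX : X ∈ M.vectors) (hY : Y ∈ M.vectors) {e : E}
    (he : X e * Y e = -1) :
    ∃ Z ∈ M.vectors, Z e = 0 ∧ ∀ f, X f * Y f ≠ -1 → Z f = signComp X Y f := by
  have h : (X e = 1 ∧ Y e = -1) ∨ (Y e = 1 ∧ X e = -1) := by
    generalize X e = a, Y e = b at *
    revert a b; decide
  rcases h with h | h
  · obtain ⟨Z, hZ, h1, h2, h3, h4⟩ := M.elimination X hX Y hY e h.1 h.2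
    refine ⟨Z, hZ, h3, fun f hf => ?_⟩
    have h1 := h1 f; have h2 := h2 f; have h4 := h4 f
    simp only [signComp_apply]
    generalize X f = a, Y f = b, Z f = c at *
    revert a b c; decide
  · obtain ⟨Z, hZ, h1, h2, h3, h4⟩ := M.elimination Y hY X hX e h.1 h.2
    refine ⟨Z, hZ, h3, fun f hf => ?_⟩
    have h1 := h1 f; have h2 := h2 f; have h4 := h4 f
    simp only [signComp_apply]
    generalize X f = a, Y f = b, Z f = c at *
    revert a b c; decide

/-- An oriented matroid from elimination in the form of the covector axioms. -/
def ofElim (V : Set (E → SignType)) (zero : (0 : E → SignType) ∈ V) (neg : ∀ X ∈ V, -X ∈ V)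
    (comp : ∀ X ∈ V, ∀ Y ∈ V, signComp X Y ∈ V)
    (elim : ∀ X ∈ V, ∀ Y ∈ V, ∀ e, X e = 1 → Y e = -1 →
      ∃ Z ∈ V, Z e = 0 ∧ ∀ f, X f * Y f ≠ -1 → Z f = signComp X Y f) : OrientedMatroid E where
  vectors := V
  zero_mem := zero
  neg_mem := neg
  comp_mem := comp
  elimination := by
    intro X hX Y hY e h1 h2
    obtain ⟨Z, hZ, h3, h4⟩ := elim X hX Y hY e h1 h2
    refine ⟨Z, hZ, fun f => ?_, fun f => ?_, h3, fun f => ?_⟩ <;>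
    · have h4 := h4 f
      simp only [signComp_apply] at h4
      generalize X f = a, Y f = b, Z f = c at *
      revert a b c; decide

/-- The vectors that vanish on `B`. -/
def vanishingOn (B : Set E) : OrientedMatroid E :=
  ofElim {X | X ∈ M.vectors ∧ ∀ f ∈ B, X f = 0}
    ⟨M.zero_mem, fun _ _ => rfl⟩
    (fun X hX => ⟨M.neg_mem X hX.1, fun f hf => by simp [hX.2 f hf]⟩)
    (fun X hX Y hY => ⟨M.comp_mem X hX.1 Y hY.1, fun f hf => by
      simp [signComp, hX.2 f hf, hY.2 f hf]⟩)
    (fun X hX Y hY e h1 h2 => by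
      obtain ⟨Z, hZ, h3, h4⟩ := M.exists_elim hX.1 hY.1 (e := e) (by rw [h1, h2]; decide)
      refine ⟨Z, ⟨hZ, fun f hf => ?_⟩, h3, h4⟩
      rw [h4 f (by rw [hX.2 f hf]; simp)]
      simp [signComp, hX.2 f hf, hY.2 f hf])

theorem neg_mem_covectors {Y : E → SignType} (hY : Y ∈ M.covectors) : -Y ∈ M.covectors :=
  fun X hX => (hY X hX).neg_right

theorem mem_covectors_of_nonneg {Y : E → SignType}
    (h : ∀ X ∈ M.vectors, (∀ e, 0 ≤ Y e * X e) → ∀ e, Y e * X e = 0) : Y ∈ M.covectors :=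
  fun X hX => (signOrthogonal_of_nonneg M.neg_mem h X hX).symm

/-- A sign vector that is orthogonal to the vectors vanishing at `e` becomes a covector after
a change at `e`. -/
theorem exists_update_mem_covectors [DecidableEq E] {Y : E → SignType} {e : E}
    (hY : ∀ X ∈ M.vectors, X e = 0 → SignOrthogonal X Y) :
    ∃ s, Function.update Y e s ∈ M.covectors := by
  by_contra! hno
  have key : ∀ s, ∃ X ∈ M.vectors, (∀ f, 0 ≤ Function.update Y e s f * X f) ∧
      ∃ f, Function.update Y e s f * X f ≠ 0 := by
    intro s
    by_contra! hs
    exact hno s (M.mem_covectors_of_nonneg hs)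
  -- Eliminating `e` between two witnesses of opposite sign there gives a vector to which `hY`
  -- applies; any nonzero product off `e` would survive in it.
  have combine : ∀ X ∈ M.vectors, ∀ X' ∈ M.vectors, X e * X' e = -1 →
      (∀ f, f ≠ e → 0 ≤ Y f * X f) → (∀ f, f ≠ e → 0 ≤ Y f * X' f) →
      ∀ f, f ≠ e → Y f * X f = 0 := by
    intro X hX X' hX' he h1 h2 f hf
    obtain ⟨Z, hZ, hZe, hZf⟩ := M.exists_elim hX hX' he
    have hpos : ∀ f, 0 ≤ Z f * Y f := by
      intro f
      by_cases hfe : f = e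
      · rw [hfe, hZe]; simp
      · have h1 := h1 f hfe; have h2 := h2 f hfe; have h3 := hZf f
        simp only [signComp_apply] at h3
        generalize X f = a, X' f = b, Z f = c, Y f = d at *
        revert a b c d; decide
    have h0 := (hY Z hZ hZe).eq_zero_of_nonneg hpos f
    have h1 := h1 f hf; have h2 := h2 f hf; have h3 := hZf f
    simp only [signComp_apply] at h3
    generalize X f = a, X' f = b, Z f = c, Y f = d at *
    revert a b c d; decide
  have nz : ∀ X ∈ M.vectors, (∀ f, f ≠ e → 0 ≤ Y f * X f) → X e = 0 →
      ∀ f, f ≠ e → Y f * X f = 0 := by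
    intro X hX h1 h2 f _
    rw [mul_comm]
    refine (hY X hX h2).eq_zero_of_nonneg (fun f => ?_) f
    by_cases hfe : f = e
    · rw [hfe, h2]; simp
    · rw [mul_comm]; exact h1 f hfe
  -- The obstruction to the value `s` at `e` must itself have sign `s` there, since `nz` excludes
  -- obstructions vanishing at `e`.
  have signed : ∀ s, s ≠ 0 → ∃ X ∈ M.vectors, (∀ f, f ≠ e → 0 ≤ Y f * X f) ∧ X e = s := by
    intro s hs
    obtain ⟨X, hX, h1, f, hf⟩ := key s
    have h1' : ∀ f, f ≠ e → 0 ≤ Y f * X f := fun f hf => by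
      have := h1 f
      rwa [Function.update_of_ne hf] at this
    refine ⟨X, hX, h1', ?_⟩
    by_contra hne
    have h0 : X e = 0 := by
      have := h1 e
      rw [Function.update_self] at this
      clear hf h1'
      generalize X e = a at *
      clear h1
      revert a s; decide
    by_cases hfe : f = e
    · rw [hfe, h0] at hf; simp at hf
    · rw [Function.update_of_ne hfe] at hf
      exact hf (nz X hX h1' h0 f hfe)
  obtain ⟨X, hX, h1, f, hf⟩ := key 0
  have hfe : f ≠ e := by
    rintro rfl
    simp at hf
  have h1' : ∀ f, f ≠ e → 0 ≤ Y f * X f := fun f hf => by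
    have := h1 f
    rwa [Function.update_of_ne hf] at this
  rw [Function.update_of_ne hfe] at hf
  by_cases h0 : X e = 0
  · exact hf (nz X hX h1' h0 f hfe)
  · obtain ⟨X', hX', h2, h3⟩ := signed (-X e) (by simpa using h0)
    refine hf (combine X hX X' hX' ?_ h1' h2 f hfe)
    rw [h3]
    clear h3
    generalize X e = a at *
    revert a; decide

/-- A sign vector that is orthogonal to the vectors vanishing on `B` becomes a covector after
a change on `B`. -/
theorem exists_mem_covectors_of_vanishing (B : Finset E) {Y : E → SignType}
    (hY : ∀ X ∈ M.vectors, (∀ e ∈ B, X e = 0) → SignOrthogonal X Y) :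
    ∃ Y' ∈ M.covectors, ∀ f ∉ B, Y' f = Y f := by
  classical
  induction B using Finset.induction_on generalizing Y with
  | empty => exact ⟨Y, fun X hX => hY X hX (by simp), fun _ _ => rfl⟩
  | insert e B he ih =>
    -- Inside `vanishingOn B` only the single entry at `e` has to be repaired.
    obtain ⟨s, hs⟩ := (M.vanishingOn (B : Set E)).exists_update_mem_covectors (Y := Y) (e := e)
      (fun X hX hXe => hY X hX.1 (by
        intro f hf
        rcases Finset.mem_insert.1 hf with rfl | hf
        · exact hXe
        · exact hX.2 f (by simpa using hf)))
    obtain ⟨Y', hY', h⟩ := ih (Y := Function.update Y e s)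
      (fun X hX hXB => hs X ⟨hX, fun f hf => hXB f (by simpa using hf)⟩)
    refine ⟨Y', hY', fun f hf => ?_⟩
    rw [Finset.mem_insert, not_or] at hf
    rw [h f hf.2, Function.update_of_ne hf.1]

/-- If each element of a finite set is in the support of a conforming sign vector, then all of
them are in the support of one such vector. -/
theorem exists_of_forall_mem (W : Set (E → SignType)) (zero : (0 : E → SignType) ∈ W)
    (comp : ∀ X ∈ W, ∀ Y ∈ W, signComp X Y ∈ W) (G : Finset E)
    (h : ∀ g ∈ G, ∃ X ∈ W, X g ≠ 0) : ∃ X ∈ W, ∀ g ∈ G, X g ≠ 0 := by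
  classical
  induction G using Finset.induction_on with
  | empty => exact ⟨0, zero, by simp⟩
  | insert e G he ih =>
    obtain ⟨X, hX, hXG⟩ := ih (fun g hg => h g (Finset.mem_insert_of_mem hg))
    obtain ⟨Y, hY, hYe⟩ := h e (Finset.mem_insert_self _ _)
    refine ⟨signComp X Y, comp X hX Y hY, fun g hg => ?_⟩
    rcases Finset.mem_insert.1 hg with rfl | hg
    · by_cases h0 : X g = 0
      · rwa [signComp_of_eq h0]
      · rwa [signComp_of_ne h0]
    · rw [signComp_of_ne (hXG g hg)]
      exact hXG g hg

/-- The Farkas lemma. The vector vanishes on `B` and is free where `s` vanishes; the covector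
vanishes where `s` does and is free on `B`. -/
theorem farkas [Finite E] (s : E → SignType) (B : Set E) {g : E} (hg : g ∉ B) (hsg : s g ≠ 0) :
    (∃ X ∈ M.vectors, (∀ f ∈ B, X f = 0) ∧ (∀ f ∉ B, 0 ≤ s f * X f) ∧ X g = s g) ∨
    (∃ Y ∈ M.covectors, (∀ f ∉ B, 0 ≤ s f * Y f) ∧ (∀ f ∉ B, s f = 0 → Y f = 0) ∧
      Y g = s g) := by
  classical
  have := Fintype.ofFinite E
  by_contra! hno
  obtain ⟨hno, hno'⟩ := hno
  let W : Set (E → SignType) := {X | X ∈ M.vectors ∧ (∀ f ∈ B, X f = 0) ∧ ∀ f ∉ B, 0 ≤ s f * X f}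
  have hcomp : ∀ X ∈ W, ∀ X' ∈ M.vectors, (∀ f ∈ B, X' f = 0) →
      (∀ f ∉ B, X f = 0 → 0 ≤ s f * X' f) → signComp X X' ∈ W := by
    rintro X ⟨hX, h1, h2⟩ X' hX' h3 h4
    refine ⟨M.comp_mem X hX X' hX', fun f hf => ?_, fun f hf => ?_⟩
    · rw [signComp_of_eq (h1 f hf), h3 f hf]
    · by_cases h0 : X f = 0
      · rw [signComp_of_eq h0]
        exact h4 f hf h0
      · rw [signComp_of_ne h0]
        exact h2 f hf
  let I : Finset E := Finset.univ.filter fun f => ∃ X ∈ W, X f ≠ 0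
  -- `X₀` has the largest support in `W`, namely `I`. If `g ∉ I`, the covector is sought as `s` with
  -- `I` deleted.
  obtain ⟨X₀, hX₀, hI⟩ := exists_of_forall_mem W ⟨M.zero_mem, fun _ _ => rfl, by simp⟩
    (fun X hX Y hY => hcomp X hX Y hY.1 hY.2.1 fun f hf _ => hY.2.2 f hf) I
    (fun f hf => (Finset.mem_filter.1 hf).2)
  have hIc : ∀ X ∈ W, ∀ f ∉ I, X f = 0 := by
    intro X hX f hf
    by_contra h0
    exact hf (Finset.mem_filter.2 ⟨Finset.mem_univ _, X, hX, h0⟩)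
  have hgI : g ∉ I := by
    intro hgI
    refine hno X₀ hX₀.1 hX₀.2.1 hX₀.2.2 ?_
    have h1 := hX₀.2.2 g hg
    have h2 := hI g hgI
    generalize X₀ g = a, s g = b at *
    clear * - h1 h2 hsg
    revert a b; decide
  let Y : E → SignType := fun f => if f ∈ I then 0 else s f
  obtain ⟨Y', hY', hYY'⟩ := M.exists_mem_covectors_of_vanishing (Finset.univ.filter (· ∈ B))
    (Y := Y) (by
      intro X hX hXB
      have hneg := (M.vanishingOn B).neg_mem
      refine (signOrthogonal_of_nonneg hneg ?_ X ⟨hX, fun f hf => hXB f (by simpa using hf)⟩).symm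
      rintro X ⟨hX, hXB⟩ hpos f
      by_contra hf0
      have hfI : f ∉ I := by
        intro h
        simp [Y, h] at hf0
      -- `X₀` overrides `X` on `I`, and off `I` the sign condition on `X` is `hpos`. Maximality of
      -- `I` then makes `X` vanish off `I`.
      have hmem : signComp X₀ X ∈ W := by
        refine hcomp X₀ hX₀ X hX hXB fun e _ he => ?_
        have := hpos e
        have heI : e ∉ I := fun h => hI e h he
        simpa [Y, heI] using this
      have := hIc _ hmem f hfI
      rw [signComp_of_eq (hIc _ hX₀ f hfI)] at this
      simp [this] at hf0)
  have hval : ∀ f ∉ B, Y' f = if f ∈ I then 0 else s f := fun f hf => hYY' f (by simpa using hf)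
  refine hno' Y' hY' (fun f hf => ?_) (fun f hf h0 => ?_) ?_
  · rw [hval f hf]
    split_ifs
    · simp
    · generalize s f = a
      revert a; decide
  · rw [hval f hf]
    simp [h0]
  · rw [hval g hg, if_neg hgI]

/-! ### Duality -/

/-- By Farkas each required entry is attained by a covector with no wrong entry; composing these
attains all of them at once. -/
theorem exists_elim_covectors [Finite E] {Y Y' : E → SignType} (hY : Y ∈ M.covectors)
    (hY' : Y' ∈ M.covectors) {e : E} (he : Y e * Y' e = -1) :
    ∃ Z ∈ M.covectors, Z e = 0 ∧ ∀ f, Y f * Y' f ≠ -1 → Z f = signComp Y Y' f := by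
  classical
  have := Fintype.ofFinite E
  let W : Set (E → SignType) :=
    {Z | Z ∈ M.covectors ∧ Z e = 0 ∧ ∀ f, Y f * Y' f ≠ -1 → Z f ≠ 0 → Z f = signComp Y Y' f}
  obtain ⟨Z, hZ, hZG⟩ := exists_of_forall_mem W
    ⟨fun X _ => .zero_right X, rfl, fun f _ h => absurd rfl h⟩
    (by
      rintro X ⟨h1, h2, h3⟩ X' ⟨h1', h2', h3'⟩
      refine ⟨fun U hU => (h1 U hU).signComp_right (h1' U hU), ?_, fun f hf hne => ?_⟩
      · rw [signComp_of_eq h2, h2']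
      · by_cases h0 : X f = 0
        · rw [signComp_of_eq h0] at hne ⊢
          exact h3' f hf hne
        · rw [signComp_of_ne h0]
          exact h3 f hf h0)
    (Finset.univ.filter fun f => Y f * Y' f ≠ -1 ∧ signComp Y Y' f ≠ 0)
    (by
      intro g hg
      obtain ⟨-, hg, hg0⟩ := Finset.mem_filter.1 hg
      -- The separated elements other than `e` are left free for the covector; `e` stays outside the
      -- free set with prescribed value `0`, which forces `Z e = 0`.
      rcases M.farkas (fun f => if Y f * Y' f = -1 then 0 else signComp Y Y' f)
        {f | f ≠ e ∧ Y f * Y' f = -1} (g := g) (by simp [hg]) (by simpa [hg] using hg0) with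
        ⟨X, hX, h1, h2, h3⟩ | ⟨Z, hZ, h1, h2, h3⟩
      · exfalso
        have ho := hY X hX
        have ho' := hY' X hX
        have hoff : ∀ f, f ≠ e → 0 ≤ X f * Y f ∧ 0 ≤ X f * Y' f := by
          intro f hf
          have h1 := h1 f
          have h2 := h2 f
          simp only [signComp_apply, Set.mem_ofPred_eq] at h1 h2
          by_cases hsep : Y f * Y' f = -1
          · simp [h1 ⟨hf, hsep⟩]
          · simp only [hsep, and_false, not_false_eq_true, if_false, forall_const] at h2
            clear h1 ho ho'
            generalize X f = a, Y f = b, Y' f = c at *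
            clear * - h2 hsep
            revert a b c; decide
        have hge : g ≠ e := by rintro rfl; exact hg he
        have hgne : X g * Y g ≠ 0 ∨ X g * Y' g ≠ 0 := by
          simp only [hg, if_false, signComp_apply] at h3 hg0
          clear ho ho' hoff
          generalize X g = a, Y g = b, Y' g = c at *
          clear * - h3 hg0
          revert a b c; decide
        have main : ∀ V : E → SignType, SignOrthogonal X V → (∀ f, f ≠ e → 0 ≤ X f * V f) →
            0 ≤ X e * V e → X g * V g = 0 ∧ X e * V e = 0 := by
          intro V hV h1 h2
          have : ∀ f, 0 ≤ X f * V f := fun f => by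
            by_cases hf : f = e
            · rw [hf]; exact h2
            · exact h1 f hf
          exact ⟨hV.eq_zero_of_nonneg this g, hV.eq_zero_of_nonneg this e⟩
        have m1 := main Y ho fun f hf => (hoff f hf).1
        have m2 := main Y' ho' fun f hf => (hoff f hf).2
        -- Since `Y` and `Y'` are opposite at `e`, either `X e = 0` and both orthogonalities apply,
        -- or one product at `e` is positive and contradicts its own orthogonality.
        have hpos : (0 ≤ X e * Y e ∧ (X e * Y e = 0 → 0 ≤ X e * Y' e)) ∧
            (0 ≤ X e * Y' e ∧ (X e * Y' e = 0 → 0 ≤ X e * Y e)) ∨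
            (0 ≤ X e * Y e ∧ X e * Y e ≠ 0) ∨ (0 ≤ X e * Y' e ∧ X e * Y' e ≠ 0) := by
          generalize X e = a, Y e = b, Y' e = c at *
          clear * - he
          revert a b c; decide
        tauto
      · refine ⟨Z, ⟨hZ, h2 e (by simp) (by simp [he]), fun f hf hne => ?_⟩, ?_⟩
        · have h1 := h1 f (by simp [hf])
          have h2 := h2 f (by simp [hf])
          simp only [hf, if_false] at h1 h2
          generalize signComp Y Y' f = a, Z f = b at *
          clear * - h1 h2 hne
          revert a b; decide
        · rw [h3]
          simpa [hg] using hg0)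
  refine ⟨Z, hZ.1, hZ.2.1, fun f hf => ?_⟩
  have h3 := hZ.2.2 f hf
  have h4 := hZG f
  simp only [Finset.mem_filter, Finset.mem_univ, true_and] at h4
  by_cases h0 : signComp Y Y' f = 0
  · by_contra hne
    exact hne (h3 fun h => hne (h.trans h0.symm))
  · exact h3 (h4 ⟨hf, h0⟩)

/-- The dual oriented matroid. -/
def dual [Finite E] : OrientedMatroid E :=
  ofElim M.covectors (fun X _ => .zero_right X) (fun _ hY => M.neg_mem_covectors hY)
    (fun _ h1 _ h2 U hU => (h1 U hU).signComp_right (h2 U hU))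
    (fun _ h1 _ h2 _ h3 h4 => M.exists_elim_covectors h1 h2 (by rw [h3, h4]; decide))

/-- If no vector conforming to `X` reached `g`, Farkas would give a covector with nonnegative
products with `X`, positive at `g`. So conforming vectors reach every `g` in the support and compose
to `X`. -/
theorem dual_covectors [Finite E] : M.dual.covectors = M.vectors := by
  classical
  have := Fintype.ofFinite E
  ext X
  constructor
  · intro hX
    let W : Set (E → SignType) := {U | U ∈ M.vectors ∧ Conforms U X}
    obtain ⟨U, hU, hUG⟩ := exists_of_forall_mem W ⟨M.zero_mem, fun f h => absurd rfl h⟩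
      (fun U hU V hV => ⟨M.comp_mem U hU.1 V hV.1, hU.2.signComp hV.2⟩)
      (Finset.univ.filter fun f => X f ≠ 0)
      (by
        intro g hg
        have hg := (Finset.mem_filter.1 hg).2
        rcases M.farkas X {f | X f = 0} (g := g) hg hg with
          ⟨U, hU, h1, h2, h3⟩ | ⟨Y, hY, h1, h2, h3⟩
        · refine ⟨U, ⟨hU, fun f hf => ?_⟩, by rwa [h3]⟩
          by_cases h0 : X f = 0
          · exact absurd (h1 f h0) hf
          · have h2 := h2 f h0
            generalize X f = a, U f = b at *
            clear * - h0 h2 hf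
            revert a b; decide
        · exfalso
          have := (hX Y hY).symm.eq_zero_of_nonneg (fun f => by
            by_cases h0 : X f = 0
            · simp [h0]
            · exact h1 f h0) g
          rw [h3] at this
          generalize X g = a at *
          clear * - this hg
          revert a; decide)
    have : U = X := by
      funext f
      by_cases h0 : X f = 0
      · rw [h0]; exact hU.2.eq_zero h0
      · exact hU.2 f (hUG f (by simpa using h0))
    exact this ▸ hU.1
  · intro hX Y hY
    exact (hY X hX).symm

theorem eq_of_vectors_eq {M N : OrientedMatroid E} (h : M.vectors = N.vectors) : M = N := by
  cases M
  cases N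
  congr

theorem dual_dual [Finite E] : M.dual.dual = M :=
  eq_of_vectors_eq M.dual_covectors

/-! ### Conformal elimination and circuits -/

/-- Elimination that keeps the signs of `X` on `F` up to new zeros. -/
theorem exists_conformal_elim [Finite E] (F : Set E) {X Y : E → SignType} (hX : X ∈ M.vectors)
    (hY : Y ∈ M.vectors) (h : ∃ e ∈ F, X e * Y e = -1) :
    ∃ Z ∈ M.vectors, (∀ f, X f * Y f ≠ -1 → Z f = signComp X Y f) ∧
      (∀ f ∈ F, X f * Z f ≠ -1) ∧ ∃ e ∈ F, X e * Y e = -1 ∧ Z e = 0 := by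
  induction hk : Set.ncard {f | f ∈ F ∧ X f * Y f = -1} using Nat.strong_induction_on
    generalizing Y with
  | _ k ih =>
    obtain ⟨e, heF, he⟩ := h
    obtain ⟨Z, hZ, hZe, hZf⟩ := M.exists_elim hX hY he
    have hsep : ∀ f, X f * Z f = -1 → X f * Y f = -1 := by
      intro f hf
      by_contra hne
      have h1 := hZf f hne
      simp only [signComp_apply] at h1
      generalize X f = a, Y f = b, Z f = c at *
      clear * - h1 hf hne
      revert a b c; decide
    by_cases hZF : ∃ e ∈ F, X e * Z e = -1
    -- `Z` takes the place of `Y`: it creates no new separation from `X` and has lost the one at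
    -- `e`.
    · obtain ⟨Z', hZ', h1, h2, e', he'F, he', hZ'e⟩ := ih _ (hk ▸ Set.ncard_lt_ncard (by
        refine ⟨fun f hf => ⟨hf.1, hsep f hf.2⟩, fun hsub => ?_⟩
        have := (hsub ⟨heF, he⟩ : e ∈ F ∧ X e * Z e = -1).2
        simp [hZe] at this)) hZ hZF rfl
      refine ⟨Z', hZ', fun f hf => ?_, h2, e', he'F, hsep _ he', hZ'e⟩
      rw [h1 f (fun h => hf (hsep f h))]
      have h3 := hZf f hf
      by_cases h0 : X f = 0
      · rw [signComp_of_eq h0, h3]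
      · rw [signComp_of_ne h0, signComp_of_ne h0]
    · push Not at hZF
      exact ⟨Z, hZ, hZf, hZF, e, heF, he, hZe⟩

/-- Every element of the support of a vector lies in a conforming circuit. -/
theorem exists_circuit_conforms [Finite E] {X : E → SignType} (hX : X ∈ M.vectors) {g : E}
    (hg : X g ≠ 0) : ∃ C, M.IsCircuit C ∧ Conforms C X ∧ C g = X g := by
  classical
  induction hk : (Function.support X).ncard using Nat.strong_induction_on generalizing X with
  | _ k ih =>
    by_cases hc : M.IsCircuit X
    · exact ⟨X, hc, .refl X, rfl⟩
    have smaller : (∃ Z ∈ M.vectors, Conforms Z X ∧ Z g = X g ∧ ∃ e, X e ≠ 0 ∧ Z e = 0) →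
        ∃ C, M.IsCircuit C ∧ Conforms C X ∧ C g = X g := by
      rintro ⟨Z, hZ, hZX, hZg, e, he, hZe⟩
      obtain ⟨C, hC, hCZ, hCg⟩ := ih _ (hk ▸ Set.ncard_lt_ncard (by
        refine ⟨fun f hf h0 => hf (hZX.eq_zero h0), fun hsub => ?_⟩
        exact hsub (show e ∈ Function.support X from he) hZe)) hZ (hZg ▸ hg) rfl
      exact ⟨C, hC, hCZ.trans hZX, hCg.trans hZg⟩
    have hX0 : X ≠ 0 := fun h => hg (by simp [h])
    have : ∃ D ∈ M.vectors, D ≠ 0 ∧ Function.support D ⊂ Function.support X := by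
      by_contra hno
      exact hc ⟨hX, hX0, hno⟩
    obtain ⟨D, hD, hD0, hDX⟩ := this
    have hsub : ∀ f, X f = 0 → D f = 0 := fun f hf => by
      by_contra h0
      exact hDX.1 (show f ∈ Function.support D from h0) hf
    obtain ⟨e₀, he₀, he₀D⟩ := Set.not_subset.1 hDX.2
    have he₀D : D e₀ = 0 := by simpa using he₀D
    have elim : ∀ D ∈ M.vectors, (∀ f, X f = 0 → D f = 0) → X g * D g ≠ -1 →
        (∃ e, X e * D e = -1) → ∃ C, M.IsCircuit C ∧ Conforms C X ∧ C g = X g := by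
      rintro D hD hsub hDg ⟨e, he⟩
      obtain ⟨Z, hZ, h1, h2, e', -, he', hZe'⟩ :=
        M.exists_conformal_elim Set.univ hX hD ⟨e, trivial, he⟩
      refine smaller ⟨Z, hZ, fun f hf => ?_, ?_, e', ?_, hZe'⟩
      · have h1 := h1 f; have h2 := h2 f trivial; have h3 := hsub f
        simp only [signComp_apply] at h1
        generalize X f = a, D f = b, Z f = c at *
        clear * - h1 h2 h3 hf
        revert a b c; decide
      · rw [h1 g hDg, signComp_of_ne hg]
      · intro h0; simp [h0] at he'
    by_cases hDg : D g = 0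
    · obtain ⟨e, he⟩ := Function.ne_iff.1 hD0
      have hXe : X e ≠ 0 := fun h => he (hsub e h)
      by_cases hsep : X e * D e = -1
      · exact elim D hD hsub (by simp [hDg]) ⟨e, hsep⟩
      · refine elim (-D) (M.neg_mem D hD) (fun f hf => by simp [hsub f hf]) (by simp [hDg])
          ⟨e, ?_⟩
        simp only [Pi.neg_apply, Pi.zero_apply] at he ⊢
        generalize X e = a, D e = b at *
        clear * - hsep hXe he
        revert a b; decide
    -- With `D'` agreeing with `X` at `g`, elimination keeps `g`. If nothing is separated, `D'`
    -- itself conforms to `X` and misses `e₀`.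
    · have : ∃ D' ∈ M.vectors, (∀ f, X f = 0 → D' f = 0) ∧ D' e₀ = 0 ∧ D' g = X g := by
        by_cases h : D g = X g
        · exact ⟨D, hD, hsub, he₀D, h⟩
        · refine ⟨-D, M.neg_mem D hD, fun f hf => by simp [hsub f hf], by simp [he₀D], ?_⟩
          simp only [Pi.neg_apply]
          generalize X g = a, D g = b at *
          clear * - hDg h hg
          revert a b; decide
      obtain ⟨D', hD', hsub', he', hg'⟩ := this
      by_cases hsep : ∃ e, X e * D' e = -1
      · refine elim D' hD' hsub' ?_ hsep
        rw [hg']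
        generalize X g = a
        revert a; decide
      · push Not at hsep
        refine smaller ⟨D', hD', fun f hf => ?_, hg', e₀, he₀, he'⟩
        have h1 := hsep f; have h2 := hsub' f
        generalize X f = a, D' f = b at *
        clear * - h1 h2 hf
        revert a b; decide

theorem exists_circuit_conforms_of_ne_zero [Finite E] {X : E → SignType} (hX : X ∈ M.vectors)
    (h0 : X ≠ 0) : ∃ C, M.IsCircuit C ∧ Conforms C X := by
  obtain ⟨g, hg⟩ := Function.ne_iff.1 h0
  obtain ⟨C, hC, hCX, -⟩ := M.exists_circuit_conforms hX hg
  exact ⟨C, hC, hCX⟩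

end OrientedMatroid

/-! ### Lexicographic extensions -/

section LexSign

variable {E : Type*} (s : E → SignType)

/-- The first nonzero sign `s a * Y a` along a list. -/
def lexSign : List E → (E → SignType) → SignType
  | [], _ => 0
  | a :: l, Y => if Y a ≠ 0 then s a * Y a else lexSign l Y

variable {s}

theorem lexSign_congr {l : List E} {X Y : E → SignType} (h : ∀ a ∈ l, X a = Y a) :
    lexSign s l X = lexSign s l Y := by
  induction l with
  | nil => rfl
  | cons a l ih =>
    simp only [lexSign, h a List.mem_cons_self, ih fun b hb => h b (List.mem_cons_of_mem _ hb)]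

theorem lexSign_neg (l : List E) (Y : E → SignType) : lexSign s l (-Y) = -lexSign s l Y := by
  induction l with
  | nil => rfl
  | cons a l ih =>
    simp only [lexSign, ih, Pi.neg_apply]
    generalize s a = b, Y a = c, lexSign s l Y = d
    revert b c d; decide

theorem lexSign_eq_zero (hs : ∀ a, s a ≠ 0) {l : List E} {Y : E → SignType} :
    lexSign s l Y = 0 ↔ ∀ a ∈ l, Y a = 0 := by
  induction l with
  | nil => simp [lexSign]
  | cons a l ih =>
    by_cases h0 : Y a = 0
    · simp [lexSign, h0, ih]
    · simp [lexSign, h0, hs a]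

theorem lexSign_append {l : List E} {Y : E → SignType} (l' : List E) (h : lexSign s l Y ≠ 0) :
    lexSign s (l ++ l') Y = lexSign s l Y := by
  induction l with
  | nil => exact absurd rfl h
  | cons a l ih =>
    by_cases h0 : Y a = 0
    · simp only [lexSign, h0, ne_eq, not_true_eq_false, if_false, List.cons_append] at h ⊢
      exact ih h
    · simp [lexSign, h0]

theorem lexSign_append_of_forall_eq_zero {l : List E} {Y : E → SignType} (l' : List E)
    (h : ∀ a ∈ l, Y a = 0) : lexSign s (l ++ l') Y = lexSign s l' Y := by
  induction l with
  | nil => rfl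
  | cons a l ih =>
    simp only [lexSign, h a List.mem_cons_self, ne_eq, not_true_eq_false, if_false,
      List.cons_append]
    exact ih fun b hb => h b (List.mem_cons_of_mem _ hb)

theorem lexSign_ne_of_forall {l : List E} {Y : E → SignType} {t : SignType} (ht : t ≠ 0)
    (h : ∀ a ∈ l, s a * Y a ≠ t) : lexSign s l Y ≠ t := by
  induction l with
  | nil => exact ht.symm
  | cons a l ih =>
    by_cases h0 : Y a = 0
    · simp only [lexSign, h0, ne_eq, not_true_eq_false, if_false]
      exact ih fun b hb => h b (List.mem_cons_of_mem _ hb)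
    · simp only [lexSign, ne_eq, h0, not_false_eq_true, if_true]
      exact h a List.mem_cons_self

/-- At the first list element where `U` or `V` is nonzero, the nonzero entries agree, both giving
`t`. So it is not separated, and `W` inherits the entry. -/
theorem lexSign_elim (hs : ∀ a, s a ≠ 0) {l : List E} {U V W : E → SignType} {t : SignType}
    (hU : lexSign s l U = t) (hV : lexSign s l V = 0 ∨ lexSign s l V = t)
    (hW : ∀ a, U a * V a ≠ -1 → W a = signComp U V a) : lexSign s l W = t := by
  induction l with
  | nil => exact hU
  | cons a l ih =>
    have hW := hW a
    have hs := hs a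
    simp only [lexSign, signComp_apply] at hU hV hW ⊢
    by_cases h0 : U a = 0 ∧ V a = 0
    · simp only [h0.1, h0.2, ne_eq, not_true_eq_false, if_false, mul_zero] at hU hV hW ⊢
      simp only [hW (by decide), not_true_eq_false, if_false]
      exact ih hU hV
    · clear ih
      generalize s a = b, U a = c, V a = d, W a = f, lexSign s l U = x, lexSign s l V = y,
        lexSign s l W = z at *
      by_cases hc : c = 0
      · subst hc
        simp only [true_and] at h0
        simp only [h0, ne_eq, not_true_eq_false, if_false, not_false_eq_true, if_true, zero_mul]
          at hU hV hW
        rw [hW (by decide), if_pos h0]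
        rcases hV with hV | hV
        · exfalso
          clear * - hV hs h0
          revert b d; decide
        · exact hV
      · simp only [hc, ne_eq, not_false_eq_true, if_true] at hU hW
        have hfc : f = c := by
          apply hW
          intro hcd
          have hd : d ≠ 0 := by rintro rfl; simp at hcd
          simp only [hd, ne_eq, not_false_eq_true, if_true] at hV
          subst hU
          clear * - hV hcd hs hc
          revert b c d; decide
        rw [hfc, if_pos hc]
        exact hU

end LexSign

theorem signComp_comm_of_not_sep {E : Type*} {X Y : E → SignType} {f : E} (h : X f * Y f ≠ -1) :
    signComp X Y f = signComp Y X f := by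
  simp only [signComp_apply]
  generalize X f = a, Y f = b at *
  revert a b; decide

namespace OrientedMatroid

variable {E : Type*} (N : OrientedMatroid E) (s : E → SignType) (l : List E)

/-- `Y` has a face on which the lexicographic sign is `t`. -/
def HasLexFace (t : SignType) (Y : E → SignType) : Prop :=
  ∃ U ∈ N.vectors, Conforms U Y ∧ lexSign s l U = t

/-- The signs that a lexicographic extension allows on the new element. -/
def LexAdmissible (Y : E → SignType) (η : SignType) : Prop :=
  (η ≠ 0 → N.HasLexFace s l η Y) ∧
    (η = 0 → (N.HasLexFace s l 1 Y ↔ N.HasLexFace s l (-1) Y))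

variable {N s l}

theorem HasLexFace.mono {t : SignType} {Y Y' : E → SignType} (h : N.HasLexFace s l t Y)
    (hY : Conforms Y Y') : N.HasLexFace s l t Y' := by
  obtain ⟨U, hU, hUY, hs⟩ := h
  exact ⟨U, hU, hUY.trans hY, hs⟩

theorem HasLexFace.neg {t : SignType} {Y : E → SignType} (h : N.HasLexFace s l t Y) :
    N.HasLexFace s l (-t) (-Y) := by
  obtain ⟨U, hU, hUY, hs⟩ := h
  exact ⟨-U, N.neg_mem U hU, hUY.neg, by rw [lexSign_neg, hs]⟩

theorem hasLexFace_neg {t : SignType} {Y : E → SignType} :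
    N.HasLexFace s l t (-Y) ↔ N.HasLexFace s l (-t) Y :=
  ⟨fun h => by simpa using h.neg, fun h => by simpa using h.neg⟩

theorem hasLexFace_self {Y : E → SignType} (hY : Y ∈ N.vectors) :
    N.HasLexFace s l (lexSign s l Y) Y :=
  ⟨Y, hY, .refl Y, rfl⟩

theorem not_hasLexFace {t : SignType} (ht : t ≠ 0) {Y : E → SignType} (h : ∀ a ∈ l, Y a = 0) :
    ¬ N.HasLexFace s l t Y := by
  rintro ⟨U, -, hUY, hU⟩
  exact lexSign_ne_of_forall ht (fun a ha => by rw [hUY.eq_zero (h a ha), mul_zero]; exact ht.symm)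
    hU

theorem exists_lexAdmissible (Y : E → SignType) : ∃ η, N.LexAdmissible s l Y η := by
  by_cases h1 : N.HasLexFace s l 1 Y
  · exact ⟨1, fun _ => h1, fun h => absurd h (by decide)⟩
  by_cases h2 : N.HasLexFace s l (-1) Y
  · exact ⟨-1, fun _ => h2, fun h => absurd h (by decide)⟩
  exact ⟨0, fun h => absurd rfl h, fun _ => iff_of_false h1 h2⟩

theorem lexAdmissible_lexSign {Y : E → SignType} (hY : Y ∈ N.vectors) (h : lexSign s l Y ≠ 0) :
    N.LexAdmissible s l Y (lexSign s l Y) :=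
  ⟨fun _ => hasLexFace_self hY, fun h' => absurd h' h⟩

/-- `Y` is a face of itself, so if faces of both signs are absent, its own lexicographic sign must
be `0`. -/
theorem LexAdmissible.zero_cases (hs : ∀ a, s a ≠ 0) {Y : E → SignType} (hY : Y ∈ N.vectors)
    (h : N.LexAdmissible s l Y 0) :
    (∀ t, t ≠ 0 → N.HasLexFace s l t Y) ∨ ∀ a ∈ l, Y a = 0 := by
  have h := h.2 rfl
  by_cases h1 : N.HasLexFace s l 1 Y
  · left
    intro t ht
    rcases SignType.ne_zero_cases ht with rfl | rfl
    · exact h1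
    · exact h.1 h1
  · right
    rw [← lexSign_eq_zero hs]
    by_contra h0
    have hself := hasLexFace_self (s := s) (l := l) hY
    rcases SignType.ne_zero_cases h0 with h0 | h0 <;> rw [h0] at hself
    · exact h1 hself
    · exact h1 (h.2 hself)

/-- The elimination is carried out on the faces; the result is composed with an ordinary eliminant
of `Y` and `Y'` to fill in the remaining entries. -/
theorem exists_elim_hasLexFace (hs : ∀ a, s a ≠ 0) {Y Y' : E → SignType} (hY : Y ∈ N.vectors)
    (hY' : Y' ∈ N.vectors) {e : E} (he : Y e * Y' e = -1) {t : SignType}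
    (h : N.HasLexFace s l t Y) (h' : N.HasLexFace s l t Y' ∨ ∀ a ∈ l, Y' a = 0) :
    ∃ Z ∈ N.vectors, Z e = 0 ∧ (∀ f, Y f * Y' f ≠ -1 → Z f = signComp Y Y' f) ∧
      N.HasLexFace s l t Z := by
  obtain ⟨Z₀, hZ₀, hZ₀e, hZ₀f⟩ := N.exists_elim hY hY' he
  have lift : ∀ V ∈ N.vectors, V e = 0 →
      (∀ f, Y f * Y' f ≠ -1 → V f ≠ 0 → V f = signComp Y Y' f) → lexSign s l V = t →
      ∃ Z ∈ N.vectors, Z e = 0 ∧ (∀ f, Y f * Y' f ≠ -1 → Z f = signComp Y Y' f) ∧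
        N.HasLexFace s l t Z := by
    intro V hV hVe hVf hVt
    refine ⟨signComp V Z₀, N.comp_mem V hV Z₀ hZ₀, ?_, fun f hf => ?_,
      V, hV, conforms_signComp_left _ _, hVt⟩
    · rw [signComp_of_eq hVe, hZ₀e]
    · by_cases h0 : V f = 0
      · rw [signComp_of_eq h0, hZ₀f f hf]
      · rw [signComp_of_ne h0, hVf f hf h0]
  obtain ⟨U, hU, hUY, hUt⟩ := h
  have hU' : ∃ U' ∈ N.vectors, Conforms U' Y' ∧ (U' e ≠ 0 ∨ lexSign s l U' = t) ∧
      (lexSign s l U' = 0 ∨ lexSign s l U' = t) := by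
    rcases h' with ⟨U', hU', hUY', hUt'⟩ | h'
    · exact ⟨U', hU', hUY', .inr hUt', .inr hUt'⟩
    · refine ⟨Y', hY', .refl _, .inl fun h0 => ?_, .inl ((lexSign_eq_zero hs).2 h')⟩
      simp [h0] at he
  obtain ⟨U', hU', hUY', h1, h2⟩ := hU'
  by_cases hUe : U e = 0
  · refine lift U hU hUe (fun f hf h0 => ?_) hUt
    rw [hUY f h0, signComp_of_ne (hUY f h0 ▸ h0)]
  by_cases hUe' : U' e = 0
  · refine lift U' hU' hUe' (fun f hf h0 => ?_) (h1.resolve_left fun h => h hUe')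
    rw [hUY' f h0, signComp_comm_of_not_sep hf, signComp_of_ne (hUY' f h0 ▸ h0)]
  obtain ⟨W, hW, hWe, hWf⟩ := N.exists_elim hU hU' (e := e) (by rw [hUY e hUe, hUY' e hUe', he])
  refine lift W hW hWe (fun f hf h0 => ?_) (lexSign_elim hs hUt h2 hWf)
  have h3 := hUY f
  have h4 := hUY' f
  have h5 := hWf f
  simp only [signComp_apply] at h5 ⊢
  generalize U f = a, U' f = b, W f = c, Y f = d, Y' f = d' at *
  have hsep : a * b ≠ -1 := by
    clear * - h3 h4 hf
    revert a b d d'; decide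
  have h5 := h5 hsep
  clear hsep
  rw [h5] at h0 ⊢
  by_cases ha : a = 0
  · simp only [ha, ne_eq, not_true_eq_false, if_false] at h0 ⊢
    have := h4 h0
    clear * - h0 hf this
    revert b d d'; decide
  · have := h3 ha
    simp [ha, ← this]

/-- A discrete intermediate value argument: an eliminant of `Y` and `Y'` with faces of one sign only
replaces the end of that sign, which reduces the separation. With no separation left, `Y ∘ Y'` has
the faces of both. -/
theorem exists_crossing [Finite E] {Y Y' : E → SignType} (hY : Y ∈ N.vectors)
    (hY' : Y' ∈ N.vectors) (h : N.HasLexFace s l 1 Y) (h' : N.HasLexFace s l (-1) Y') :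
    ∃ Z ∈ N.vectors, (∀ f, Y f * Y' f ≠ -1 → Z f = signComp Y Y' f) ∧
      N.LexAdmissible s l Z 0 := by
  induction hk : Set.ncard {f | Y f * Y' f = -1} using Nat.strong_induction_on
    generalizing Y Y' with
  | _ k ih =>
    by_cases hsep : ∃ e, Y e * Y' e = -1
    · obtain ⟨e, he⟩ := hsep
      obtain ⟨Z, hZ, hZe, hZf⟩ := N.exists_elim hY hY' he
      by_cases hiff : N.HasLexFace s l 1 Z ↔ N.HasLexFace s l (-1) Z
      · exact ⟨Z, hZ, hZf, fun h => absurd rfl h, fun _ => hiff⟩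
      by_cases h1 : N.HasLexFace s l 1 Z
      · have hsub : ∀ f, Z f * Y' f = -1 → Y f * Y' f = -1 := by
          intro f hf
          by_contra hne
          have h1 := hZf f hne
          simp only [signComp_apply] at h1
          generalize Y f = a, Y' f = b, Z f = c at *
          clear * - h1 hf hne
          revert a b c; decide
        obtain ⟨W, hW, hWf, hWa⟩ := ih _ (hk ▸ Set.ncard_lt_ncard (by
          refine ⟨hsub, fun hsub' => ?_⟩
          have := hsub' he
          simp [hZe] at this)) hZ hY' h1 h' rfl
        refine ⟨W, hW, fun f hf => ?_, hWa⟩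
        rw [hWf f fun h => hf (hsub f h)]
        have h3 := hZf f hf
        simp only [signComp_apply] at h3 ⊢
        generalize Y f = a, Y' f = b, Z f = c at *
        clear * - h3 hf
        revert a b c; decide
      · have h2 : N.HasLexFace s l (-1) Z := by tauto
        have hsub : ∀ f, Y f * Z f = -1 → Y f * Y' f = -1 := by
          intro f hf
          by_contra hne
          have h1 := hZf f hne
          simp only [signComp_apply] at h1
          generalize Y f = a, Y' f = b, Z f = c at *
          clear * - h1 hf hne
          revert a b c; decide
        obtain ⟨W, hW, hWf, hWa⟩ := ih _ (hk ▸ Set.ncard_lt_ncard (by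
          refine ⟨hsub, fun hsub' => ?_⟩
          have := hsub' he
          simp [hZe] at this)) hY hZ h h2 rfl
        refine ⟨W, hW, fun f hf => ?_, hWa⟩
        rw [hWf f fun h => hf (hsub f h)]
        have h3 := hZf f hf
        simp only [signComp_apply] at h3 ⊢
        generalize Y f = a, Y' f = b, Z f = c at *
        clear * - h3 hf
        revert a b c; decide
    · push Not at hsep
      refine ⟨signComp Y Y', N.comp_mem _ hY _ hY', fun _ _ => rfl, fun h => absurd rfl h, fun _ =>
        iff_of_true (h.mono (conforms_signComp_left _ _)) (h'.mono fun f hf => ?_)⟩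
      rw [signComp_comm_of_not_sep (hsep f), signComp_of_ne hf]

theorem exists_elim_lexAdmissible [Finite E] (hs : ∀ a, s a ≠ 0) {Y Y' : E → SignType}
    (hY : Y ∈ N.vectors) (hY' : Y' ∈ N.vectors) {e : E} (he : Y e * Y' e = -1) {η η' : SignType}
    (h : N.LexAdmissible s l Y η) (h' : N.LexAdmissible s l Y' η') :
    ∃ Z ∈ N.vectors, Z e = 0 ∧ (∀ f, Y f * Y' f ≠ -1 → Z f = signComp Y Y' f) ∧
      ∃ ζ, N.LexAdmissible s l Z ζ ∧ (η * η' ≠ -1 → ζ = if η ≠ 0 then η else η') := by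
  have he' : Y' e * Y e = -1 := by rwa [mul_comm]
  have swap : ∀ t, N.HasLexFace s l t Y' → (N.HasLexFace s l t Y ∨ ∀ a ∈ l, Y a = 0) →
      ∃ Z ∈ N.vectors, Z e = 0 ∧ (∀ f, Y f * Y' f ≠ -1 → Z f = signComp Y Y' f) ∧
        N.HasLexFace s l t Z := by
    intro t h1 h2
    obtain ⟨Z, hZ, hZe, hZf, hZt⟩ := exists_elim_hasLexFace hs hY' hY he' h1 h2
    refine ⟨Z, hZ, hZe, fun f hf => ?_, hZt⟩
    rw [hZf f (by rwa [mul_comm]), signComp_comm_of_not_sep hf]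
  have cases_of : ∀ {X : E → SignType} {ξ t : SignType}, X ∈ N.vectors → N.LexAdmissible s l X ξ →
      t ≠ 0 → (ξ = 0 ∨ ξ = t) → N.HasLexFace s l t X ∨ ∀ a ∈ l, X a = 0 := by
    rintro X ξ t hX hXa ht (rfl | rfl)
    · exact (hXa.zero_cases hs hX).imp (fun h => h t ht) id
    · exact .inl (hXa.1 ht)
  by_cases hsep : η * η' = -1
  · obtain ⟨Z, hZ, hZe, hZf⟩ := N.exists_elim hY hY' he
    obtain ⟨ζ, hζ⟩ := exists_lexAdmissible (N := N) (s := s) (l := l) Z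
    exact ⟨Z, hZ, hZe, hZf, ζ, hζ, fun h => absurd hsep h⟩
  by_cases hη : η = 0
  · subst hη
    by_cases hη' : η' = 0
    · subst hη'
      by_cases hv : (∀ a ∈ l, Y a = 0) ∧ ∀ a ∈ l, Y' a = 0
      · obtain ⟨Z, hZ, hZe, hZf⟩ := N.exists_elim hY hY' he
        have hZl : ∀ a ∈ l, Z a = 0 := fun a ha => by
          have h1 := hv.1 a ha
          have h2 := hv.2 a ha
          rw [hZf a (by rw [h1]; simp), signComp_of_eq h1, h2]
        exact ⟨Z, hZ, hZe, hZf, 0, ⟨fun h => absurd rfl h, fun _ =>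
          iff_of_false (not_hasLexFace (by decide) hZl) (not_hasLexFace (by decide) hZl)⟩,
          fun _ => by simp⟩
      -- Eliminants with a positive and with a negative face both exist; crossing between them gives
      -- one on which `0` is admissible, without losing the zero at `e`.
      · have both : ∀ t, t ≠ 0 → ∃ Z ∈ N.vectors, Z e = 0 ∧
            (∀ f, Y f * Y' f ≠ -1 → Z f = signComp Y Y' f) ∧ N.HasLexFace s l t Z := by
          intro t ht
          have c1 := cases_of hY h ht (.inl rfl)
          have c2 := cases_of hY' h' ht (.inl rfl)
          by_cases hYt : N.HasLexFace s l t Y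
          · exact exists_elim_hasLexFace hs hY hY' he hYt c2
          · refine swap t (c2.resolve_right fun h2 => hv ⟨c1.resolve_left hYt, h2⟩) c1
        obtain ⟨Z₁, hZ₁, hZe₁, hZf₁, ht₁⟩ := both 1 (by decide)
        obtain ⟨Z₂, hZ₂, hZe₂, hZf₂, ht₂⟩ := both (-1) (by decide)
        obtain ⟨Z, hZ, hZf, hZa⟩ := exists_crossing hZ₁ hZ₂ ht₁ ht₂
        refine ⟨Z, hZ, ?_, fun f hf => ?_, 0, hZa, by simp⟩
        · rw [hZf e (by rw [hZe₁]; simp), signComp_of_eq hZe₁, hZe₂]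
        · have h1 := hZf₁ f hf
          have h2 := hZf₂ f hf
          have h3 := hZf f
          rw [signComp_apply Z₁, h1, h2] at h3
          generalize signComp Y Y' f = a, Z f = b at *
          clear * - h3
          revert a b; decide
    · obtain ⟨Z, hZ, hZe, hZf, hZt⟩ := swap η' (h'.1 hη') (cases_of hY h hη' (.inl rfl))
      exact ⟨Z, hZ, hZe, hZf, η', ⟨fun _ => hZt, fun h => absurd h hη'⟩, by simp⟩
  · have hη' : η' = 0 ∨ η' = η := by
      clear * - hsep hη
      revert η η'; decide
    obtain ⟨Z, hZ, hZe, hZf, hZt⟩ :=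
      exists_elim_hasLexFace hs hY hY' he (h.1 hη) (cases_of hY' h' hη hη')
    exact ⟨Z, hZ, hZe, hZf, η, ⟨fun _ => hZt, fun h => absurd h hη⟩, by simp [hη]⟩

theorem LexAdmissible.neg {Y : E → SignType} {η : SignType} (h : N.LexAdmissible s l Y η) :
    N.LexAdmissible s l (-Y) (-η) := by
  refine ⟨fun hη => (h.1 (by simpa using hη)).neg, fun hη => ?_⟩
  rw [hasLexFace_neg, hasLexFace_neg, neg_neg]
  exact (h.2 (by simpa using hη)).symm

/-- Faces of `Y` remain faces of the composition. The delicate case is `Y` vanishing on `l`: then a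
face `U` of `Y'` becomes `Y ∘ U` with the same lexicographic sign. -/
theorem LexAdmissible.signComp (hs : ∀ a, s a ≠ 0) {Y Y' : E → SignType} (hY : Y ∈ N.vectors)
    (hY' : Y' ∈ N.vectors) {η η' : SignType} (h : N.LexAdmissible s l Y η)
    (h' : N.LexAdmissible s l Y' η') :
    N.LexAdmissible s l (signComp Y Y') (if η ≠ 0 then η else η') := by
  by_cases hη : η = 0
  · subst hη
    simp only [ne_eq, not_true_eq_false, if_false]
    rcases h.zero_cases hs hY with hf | hf
    · refine ⟨fun h => (hf _ h).mono (conforms_signComp_left _ _), fun _ => iff_of_true ?_ ?_⟩ <;>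
      exact (hf _ (by decide)).mono (conforms_signComp_left _ _)
    · have key : ∀ t, N.HasLexFace s l t Y' → N.HasLexFace s l t (_root_.signComp Y Y') := by
        rintro t ⟨U, hU, hUY, hUt⟩
        refine ⟨_root_.signComp Y U, N.comp_mem _ hY _ hU, hUY.signComp_right Y, ?_⟩
        rw [← hUt]
        exact lexSign_congr fun a ha => signComp_of_eq (hf a ha)
      refine ⟨fun hη => key _ (h'.1 hη), fun hη => ?_⟩
      subst hη
      rcases h'.zero_cases hs hY' with h1 | h1
      · exact iff_of_true (key _ (h1 _ (by decide))) (key _ (h1 _ (by decide)))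
      · have h2 : ∀ a ∈ l, _root_.signComp Y Y' a = 0 := fun a ha => by
          rw [signComp_of_eq (hf a ha), h1 a ha]
        exact iff_of_false (not_hasLexFace (by decide) h2) (not_hasLexFace (by decide) h2)
  · simp only [ne_eq, hη, not_false_eq_true, if_true]
    exact ⟨fun _ => (h.1 hη).mono (conforms_signComp_left _ _), fun h => absurd h hη⟩

variable (N s l) in
/-- The one-element lift of `N` whose dual is a lexicographic extension. -/
def lexLift [Finite E] (hs : ∀ a, s a ≠ 0) : OrientedMatroid (Option E) :=
  ofElim {Y | (fun e => Y (some e)) ∈ N.vectors ∧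
      N.LexAdmissible s l (fun e => Y (some e)) (Y none)}
    ⟨N.zero_mem, fun h => absurd rfl h, fun _ => iff_of_false
      (not_hasLexFace (by decide) fun _ _ => rfl) (not_hasLexFace (by decide) fun _ _ => rfl)⟩
    (fun _ hY => ⟨N.neg_mem _ hY.1, hY.2.neg⟩)
    (fun _ hY _ hY' => ⟨N.comp_mem _ hY.1 _ hY'.1, hY.2.signComp hs hY.1 hY'.1 hY'.2⟩)
    (by
      rintro Y ⟨hY, hYa⟩ Y' ⟨hY', hYa'⟩ e h1 h2
      cases e with
      | none =>
        obtain ⟨Z, hZ, hZf, hZa⟩ := exists_crossing hY hY' (h1 ▸ hYa.1 (by rw [h1]; decide))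
          (h2 ▸ hYa'.1 (by rw [h2]; decide))
        refine ⟨fun o => o.elim 0 Z, ⟨hZ, hZa⟩, rfl, fun f hf => ?_⟩
        cases f with
        | none => exact absurd (by rw [h1, h2]; decide) hf
        | some f => exact hZf f hf
      | some e =>
        obtain ⟨Z, hZ, hZe, hZf, ζ, hζ, hζ'⟩ := exists_elim_lexAdmissible hs hY hY' (e := e)
          (by rw [h1, h2]; decide) hYa hYa'
        refine ⟨fun o => o.elim ζ Z, ⟨hZ, hζ⟩, hZe, fun f hf => ?_⟩
        cases f with
        | none => exact hζ' hf
        | some f => exact hZf f hf)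

/-- The lexicographic extension of `M` by an element that has the sign `lexSign s l Y` on the
covectors `Y`. -/
def lexExtension [Finite E] (M : OrientedMatroid E) (s : E → SignType) (l : List E)
    (hs : ∀ a, s a ≠ 0) : OrientedMatroid (Option E) :=
  (M.dual.lexLift s l hs).dual

theorem mem_covectors_lexExtension [Finite E] {M : OrientedMatroid E} {hs : ∀ a, s a ≠ 0}
    {Y : Option E → SignType} :
    Y ∈ (M.lexExtension s l hs).covectors ↔ (fun e => Y (some e)) ∈ M.covectors ∧
      M.dual.LexAdmissible s l (fun e => Y (some e)) (Y none) := by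
  rw [lexExtension, dual_covectors]
  rfl

theorem mem_vectors_lexExtension_of_nonneg [Finite E] {M : OrientedMatroid E}
    {hs : ∀ a, s a ≠ 0} {X : Option E → SignType}
    (h : ∀ Y ∈ (M.lexExtension s l hs).covectors, (∀ e, 0 ≤ X e * Y e) → ∀ e, X e * Y e = 0) :
    X ∈ (M.lexExtension s l hs).vectors := by
  rw [← dual_covectors]
  exact mem_covectors_of_nonneg _ h

/-- The new element is balanced by the signs `-s` on `l`. A covector with nonnegative products has
no face of sign `1`, hence is `0` at `q`, and then vanishes on `l`. -/
theorem lexExtension_vector_mem [Finite E] [DecidableEq E] (M : OrientedMatroid E)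
    (hs : ∀ a, s a ≠ 0) :
    (fun o => o.elim 1 fun a => if a ∈ l then -s a else 0 : Option E → SignType) ∈
      (M.lexExtension s l hs).vectors := by
  refine mem_vectors_lexExtension_of_nonneg fun Y hY hpos => ?_
  rw [mem_covectors_lexExtension] at hY
  obtain ⟨hY, hYa⟩ := hY
  have hno : ¬ M.dual.HasLexFace s l 1 (fun e => Y (some e)) := by
    rintro ⟨U, -, hUY, hU⟩
    refine lexSign_ne_of_forall (by decide) (fun a ha => ?_) hU
    have h1 : U a ≠ 0 → U a = Y (some a) := hUY a
    have h2 := hpos (some a)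
    simp only [Option.elim_some, ha, if_true] at h2
    generalize s a = b, U a = c, Y (some a) = d at *
    clear * - h1 h2
    revert b c d; decide
  have h0 : Y none = 0 := by
    have h1 := hYa.1
    have h2 := hpos none
    simp only [Option.elim_none, one_mul] at h2
    by_contra h0
    rcases SignType.ne_zero_cases h0 with h | h <;> rw [h] at h1 h2
    · exact hno (h1 (by decide))
    · exact absurd h2 (by decide)
  rw [h0] at hYa
  have hv := (hYa.zero_cases hs hY).resolve_left fun h => hno (h 1 (by decide))
  intro o
  cases o with
  | none => simp [h0]
  | some a =>
    by_cases ha : a ∈ l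
    · simp [hv a ha]
    · simp [ha]

/-- Every covector of `M` admits some sign at `q`, so the covectors of the extension restrict onto
those of `M`; orthogonality to a vector that is `0` at `q` sees only the restriction. -/
theorem isOnePointExtension_lexExtension [Finite E] (M : OrientedMatroid E)
    (hs : ∀ a, s a ≠ 0) : M.IsOnePointExtension (M.lexExtension s l hs) := by
  classical
  refine ⟨?_, _, lexExtension_vector_mem M hs, by simp⟩
  have orth : ∀ (X : Option E → SignType) (Y : Option E → SignType), X none = 0 →
      (SignOrthogonal X Y ↔ SignOrthogonal (fun e => X (some e)) (fun e => Y (some e))) := by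
    intro X Y h0
    simp [SignOrthogonal, Option.forall, Option.exists, h0]
  ext X
  constructor
  · rintro ⟨X, hX, h0, rfl⟩
    rw [← M.dual_covectors]
    intro Y hY
    obtain ⟨η, hη⟩ := exists_lexAdmissible (N := M.dual) (s := s) (l := l) Y
    have hmem : (fun o => o.elim η Y : Option E → SignType) ∈ (M.lexExtension s l hs).covectors :=
      mem_covectors_lexExtension.2 ⟨hY, hη⟩
    exact ((orth _ _ h0).1 (hmem X hX)).symm
  · intro hX
    refine ⟨fun o => o.elim 0 X, ?_, rfl, rfl⟩
    rw [← dual_covectors]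
    intro Y hY
    exact ((orth (fun o => o.elim 0 X) Y rfl).2
      ((mem_covectors_lexExtension.1 hY).1 X hX)).symm

end OrientedMatroid

/-! ### Transversals of complementary pairs -/

theorem SignOrthogonal.eq_zero_of_single {E : Type*} {X Y : E → SignType}
    (h : SignOrthogonal X Y) {e : E} (h0 : ∀ f, f ≠ e → X f * Y f = 0) : X e * Y e = 0 := by
  rcases h with h | ⟨⟨f, hf⟩, g, hg⟩
  · exact h e
  · have key : ∀ f, X f * Y f ≠ 0 → f = e := fun f hf => by
      by_contra hne
      exact hf (h0 f hne)
    rw [key f (by rw [hf]; decide)] at hf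
    rw [key g (by rw [hg]; decide), hf] at hg
    exact absurd hg (by decide)

/-- Used for fundamental vectors and covectors, which meet in at most one pair, to transfer signs
between them. -/
theorem SignOrthogonal.eq_neg_of_pair {E : Type*} {X Y : E → SignType}
    (h : SignOrthogonal X Y) {e e' : E} (h0 : ∀ f, f ≠ e → f ≠ e' → X f * Y f = 0) :
    X e * Y e = -(X e' * Y e') := by
  rcases h with h | ⟨⟨f, hf⟩, g, hg⟩
  · rw [h e, h e']; rfl
  · have key : ∀ f, X f * Y f ≠ 0 → f = e ∨ f = e' := fun f hf => by
      by_contra! hne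
      exact hf (h0 f hne.1 hne.2)
    rcases key f (by rw [hf]; decide) with h1 | h1 <;>
    rcases key g (by rw [hg]; decide) with h2 | h2 <;> rw [h1] at hf <;> rw [h2] at hg
    · exact absurd (hf.symm.trans hg) (by decide)
    · rw [hf, hg, neg_neg]
    · rw [hf, hg]
    · exact absurd (hf.symm.trans hg) (by decide)

section Transversal

variable {E : Type*} (bar : E → E)

/-- `A` contains exactly one element of each pair `e, bar e`. -/
def IsTransversal (A : Set E) : Prop :=
  ∀ e, bar e ∈ A ↔ e ∉ A

variable {bar} {A S : Set E}

theorem IsTransversal.compl (hA : IsTransversal bar A) : IsTransversal bar Aᶜ := fun e => by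
  simp [hA e]

theorem IsTransversal.bar_ne (hA : IsTransversal bar A) (e : E) : bar e ≠ e := by
  intro h
  have := hA e
  rw [h] at this
  tauto

theorem IsTransversal.switch (hbar : Function.Involutive bar) (hA : IsTransversal bar A) {e : E}
    (he : e ∈ A) : IsTransversal bar (insert (bar e) (A \ {e})) := by
  intro f
  have h1 := hA f
  have h2 := hA.bar_ne e
  simp only [Set.mem_insert_iff, Set.mem_sdiff, Set.mem_singleton_iff, hbar.injective.eq_iff,
    not_or, not_and, not_not]
  by_cases hf : f = e
  · subst hf
    simp [h2.symm]
  · by_cases hf' : f = bar e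
    · subst hf'
      simp [hbar e, h2]
    · have : bar f ≠ e := fun h => hf' (by rw [← h, hbar f])
      tauto

theorem insert_bar_switch (hbar : Function.Involutive bar) (hA : IsTransversal bar A) {e : E}
    (he : e ∈ A) :
    insert (bar (bar e)) (insert (bar e) (A \ {e}) \ {bar e}) = A := by
  have h1 : bar e ∉ A := fun h => (hA e).1 h he
  ext f
  simp only [hbar e, Set.mem_insert_iff, Set.mem_sdiff, Set.mem_singleton_iff]
  by_cases hf : f = e
  · simp [hf, he]
  · by_cases hf' : f = bar e
    · simp [hf', h1, hA.bar_ne e]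
    · simp [hf, hf']

theorem compl_switch (hA : IsTransversal bar A) (hbar : Function.Involutive bar) {e : E} :
    (insert (bar e) (A \ {e}))ᶜ = insert (bar (bar e)) (Aᶜ \ {bar e}) := by
  have h2 := hA.bar_ne e
  ext f
  simp only [hbar e, Set.mem_insert_iff, Set.mem_sdiff, Set.mem_singleton_iff, Set.mem_compl_iff]
  by_cases hf : f = e
  · simp [hf, h2.symm]
  · simp [hf]; tauto

/-- Every transversal is reached from a given one by switching pairs. -/
theorem transversal_induction [Finite E] (hbar : Function.Involutive bar)
    (hS : IsTransversal bar S) {P : Set E → Prop} (h0 : P S)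
    (h : ∀ A, IsTransversal bar A → P A → ∀ e ∈ A, P (insert (bar e) (A \ {e})))
    (hA : IsTransversal bar A) : P A := by
  induction hk : (A \ S).ncard using Nat.strong_induction_on generalizing A with
  | _ k ih =>
    by_cases hsub : A ⊆ S
    · have : A = S := by
        refine hsub.antisymm fun e he => ?_
        by_contra heA
        exact (hS e).1 (hsub ((hA e).2 heA)) he
      exact this ▸ h0
    · obtain ⟨e, heA, heS⟩ := Set.not_subset.1 hsub
      have hA' := hA.switch hbar heA
      have := ih _ (hk ▸ Set.ncard_lt_ncard (by
        refine ⟨?_, fun hsub' => ?_⟩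
        · rintro f ⟨hf | hf, hfS⟩
          · exact absurd ((hS e).2 heS) (hf ▸ hfS)
          · exact ⟨hf.1, hfS⟩
        · rcases (hsub' ⟨heA, heS⟩).1 with h | h
          · exact hA.bar_ne e h.symm
          · exact h.2 rfl)) hA' rfl
      have := h _ hA' this (bar e) (Set.mem_insert _ _)
      rwa [insert_bar_switch hbar hA heA] at this

theorem exists_transversal_mem (hbar : Function.Involutive bar) (hA : IsTransversal bar A)
    (e : E) : ∃ A', IsTransversal bar A' ∧ e ∈ A' ∧
      ∀ f, f ≠ e → f ≠ bar e → (f ∈ A' ↔ f ∈ A) := by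
  by_cases he : e ∈ A
  · exact ⟨A, hA, he, fun _ _ _ => Iff.rfl⟩
  · refine ⟨_, hA.switch hbar ((hA e).2 he), by simp [hbar e], fun f h1 h2 => ?_⟩
    simp [hbar e, h1, h2]

end Transversal

/-! ### Exchange and fundamental signs on transversals -/

namespace OrientedMatroid

variable {E : Type*} {N : OrientedMatroid E} {bar : E → E} {A S : Set E} {ε : SignType}

variable (N) in
/-- No nonzero covector vanishes on `A`. -/
def SpannedBy (A : Set E) : Prop :=
  ∀ Y ∈ N.covectors, (∀ e ∈ A, Y e = 0) → Y = 0

theorem SpannedBy.exists_vector [Finite E] (hA : N.SpannedBy A) {g : E} (hg : g ∉ A) :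
    ∃ C ∈ N.vectors, (∀ f ∉ A, f ≠ g → C f = 0) ∧ C g = 1 := by
  classical
  rcases N.farkas (fun f => if f = g then 1 else 0) {f | f ∉ A ∧ f ≠ g} (g := g) (by simp)
    (by simp) with ⟨C, hC, h1, h2, h3⟩ | ⟨Y, hY, h1, h2, h3⟩
  · exact ⟨C, hC, fun f hf hfg => h1 f ⟨hf, hfg⟩, by simpa using h3⟩
  · have := hA Y hY fun e he => h2 e (by simp [he]) (by
      rw [if_neg]
      rintro rfl
      exact hg he)
    simp [this] at h3

/-- Since the covectors of the dual are the vectors, the hypothesis says that `A` is independent. -/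
theorem SpannedBy.exists_covector [Finite E] (hA : N.dual.SpannedBy Aᶜ) {g : E} (hg : g ∈ A) :
    ∃ D ∈ N.covectors, (∀ f ∈ A, f ≠ g → D f = 0) ∧ D g = 1 := by
  obtain ⟨D, hD, h1, h2⟩ := hA.exists_vector (g := g) (by simpa using hg)
  exact ⟨D, hD, fun f hf hfg => h1 f (by simpa using hf) hfg, h2⟩

/-- A covector vanishing on the new set meets `C` at most in `e`, so it vanishes at `e` too, hence
on `A`. -/
theorem SpannedBy.switch (hA : N.SpannedBy A) {e : E} {C : E → SignType} (hC : C ∈ N.vectors)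
    (hCA : ∀ f ∉ A, f ≠ bar e → C f = 0) (hCe : C e ≠ 0) :
    N.SpannedBy (insert (bar e) (A \ {e})) := by
  intro Y hY hYA
  refine hA Y hY fun f hf => ?_
  by_cases hfe : f = e
  · have := (hY C hC).eq_zero_of_single (e := e) fun f hf => by
      by_cases hfA : f = bar e ∨ f ∈ A
      · rw [hYA f (by tauto), mul_zero]
      · rw [hCA f (by tauto) (by tauto), zero_mul]
    rw [hfe]
    generalize C e = a, Y e = b at *
    clear * - hCe this
    revert a b; decide
  · exact hYA f (.inr ⟨hf, hfe⟩)

variable (N bar ε) in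
/-- The signs of the fundamental vectors and covectors of the transversals at a pair. -/
def PairCondition : Prop :=
  ∀ A, IsTransversal bar A → ∀ e ∈ A,
    (∃ C ∈ N.vectors, (∀ f ∉ A, f ≠ bar e → C f = 0) ∧ C e * C (bar e) = -ε) ∧
    ∃ D ∈ N.covectors, (∀ f ∈ A, f ≠ e → D f = 0) ∧ D e * D (bar e) = ε

theorem PairCondition.dual [Finite E] (hbar : Function.Involutive bar)
    (h : N.PairCondition bar ε) : N.dual.PairCondition bar (-ε) := by
  intro A hA e he
  obtain ⟨⟨C, hC, h1, h2⟩, D, hD, h3, h4⟩ := h Aᶜ hA.compl (bar e) (by simpa [hA e] using he)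
  rw [hbar e] at h1 h2 h4
  refine ⟨⟨D, hD, fun f hf hfe => h3 f hf hfe, by rw [mul_comm, h4, neg_neg]⟩, C, ?_,
    fun f hf hfe => h1 f (by simpa using hf) hfe, by rw [mul_comm, h2]⟩
  rw [dual_covectors]
  exact hC

/-- The sign of `D` on the pair is forced by orthogonality to `C`. -/
theorem pairCondition_of_spannedBy
    (h : ∀ A, IsTransversal bar A → ∀ e ∈ A, ∃ C ∈ N.vectors, (∀ f ∉ A, f ≠ bar e → C f = 0) ∧
      C e * C (bar e) = -ε)
    (h' : ∀ A, IsTransversal bar A → ∀ e ∈ A, ∃ D ∈ N.covectors, (∀ f ∈ A, f ≠ e → D f = 0) ∧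
      D e = 1) (hε : ε ≠ 0) : N.PairCondition bar ε := by
  intro A hA e he
  obtain ⟨C, hC, hCA, hCe⟩ := h A hA e he
  obtain ⟨D, hD, hDA, hDe⟩ := h' A hA e he
  refine ⟨⟨C, hC, hCA, hCe⟩, D, hD, hDA, ?_⟩
  have := (hD C hC).eq_neg_of_pair (e := e) (e' := bar e) fun f h1 h2 => by
    by_cases hf : f ∈ A
    · rw [hDA f hf h1, mul_zero]
    · rw [hCA f hf h2, zero_mul]
  rw [hDe] at this ⊢
  generalize C e = a, C (bar e) = b, D (bar e) = c at *
  clear * - this hCe hε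
  revert a b c ε; decide

/-- A fundamental vector has no full pair except possibly `e, bar e`, so only the sign `-ε` there
keeps it from being excluded. In particular it is nonzero at `e`, which allows exchange along all
transversals; vectors supported in a transversal are excluded outright. -/
theorem pairCondition_of_no_vector [Finite E] (hbar : Function.Involutive bar)
    (hS : IsTransversal bar S) (hspan : N.SpannedBy S) (hε : ε ≠ 0)
    (h : ∀ X ∈ N.vectors, (∀ e, 0 ≤ ε * (X e * X (bar e))) → X = 0) :
    (∀ A, IsTransversal bar A → N.SpannedBy A) ∧ N.PairCondition bar ε := by
  have sign : ∀ A, IsTransversal bar A → ∀ e ∈ A, ∀ C ∈ N.vectors,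
      (∀ f ∉ A, f ≠ bar e → C f = 0) → C (bar e) = 1 → C e * C (bar e) = -ε := by
    intro A hA e he C hC hCA hCe
    by_contra hne
    have hpos : 0 ≤ ε * (C e * C (bar e)) := by
      generalize C e * C (bar e) = a at *
      clear * - hne hε
      revert a ε; decide
    have := h C hC fun f => by
      by_cases h1 : f = e
      · rwa [h1]
      · by_cases h2 : f = bar e
        · rwa [h2, hbar e, mul_comm (C (bar e))]
        · have : C f * C (bar f) = 0 := by
            by_cases hf : f ∈ A
            · rw [hCA (bar f) (fun h => (hA f).1 h hf) (fun h => h1 (hbar.injective h)), mul_zero]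
            · rw [hCA f hf h2, zero_mul]
          simp [this]
    simp [this] at hCe
  have span : ∀ A, IsTransversal bar A → N.SpannedBy A := by
    intro A hA
    refine transversal_induction hbar hS hspan (fun A hA hspan e he => ?_) hA
    obtain ⟨C, hC, hCA, hCe⟩ := hspan.exists_vector (g := bar e) (fun h => (hA e).1 h he)
    refine hspan.switch hC hCA fun h0 => ?_
    have := sign A hA e he C hC hCA hCe
    rw [h0, zero_mul] at this
    exact hε (by simpa using this.symm)
  refine ⟨span, pairCondition_of_spannedBy (fun A hA e he => ?_) (fun A hA e he => ?_) hε⟩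
  · obtain ⟨C, hC, hCA, hCe⟩ := (span A hA).exists_vector (g := bar e) (fun h => (hA e).1 h he)
    exact ⟨C, hC, hCA, sign A hA e he C hC hCA hCe⟩
  · refine SpannedBy.exists_covector (fun X hX hXA => ?_) he
    rw [dual_covectors] at hX
    refine h X hX fun f => ?_
    have : X f * X (bar f) = 0 := by
      by_cases hf : f ∈ A
      · rw [hXA (bar f) (by simpa [hA f] using hf), mul_zero]
      · rw [hXA f hf, zero_mul]
    simp [this]

theorem PairCondition.eq_zero [Finite E] (hbar : Function.Involutive bar)
    (hS : IsTransversal bar S) (hε : ε ≠ 0) (h : N.PairCondition bar ε) {X : E → SignType}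
    (hX : X ∈ N.vectors) (hXε : ∀ e, 0 ≤ ε * (X e * X (bar e))) : X = 0 := by
  induction hk : Set.ncard {e | X e ≠ 0 ∧ X (bar e) ≠ 0} using Nat.strong_induction_on
    generalizing X with
  | _ k ih =>
    -- `A` takes the supported element of each half-supported pair and follows `S` elsewhere, so off
    -- `A` the support of `X` lies in full pairs.
    let A : Set E := {e | (X e ≠ 0 ∧ X (bar e) = 0) ∨ ((X e = 0 ↔ X (bar e) = 0) ∧ e ∈ S)}
    have hA : IsTransversal bar A := by
      intro e
      have := hS e
      simp only [A, Set.mem_ofPred_eq, hbar e]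
      tauto
    have hXA : ∀ f ∉ A, X f ≠ 0 → X (bar f) ≠ 0 := by
      intro f hf h1 h2
      exact hf (.inl ⟨h1, h2⟩)
    by_contra hX0
    by_cases hfull : ∃ e, X e ≠ 0 ∧ X (bar e) ≠ 0
    · have : ∃ e ∈ A, X e ≠ 0 ∧ X (bar e) ≠ 0 := by
        obtain ⟨e, h1, h2⟩ := hfull
        by_cases he : e ∈ A
        · exact ⟨e, he, h1, h2⟩
        · exact ⟨bar e, (hA e).2 he, h2, by rwa [hbar e]⟩
      obtain ⟨e, heA, h1, h2⟩ := this
      have : ∃ C ∈ N.vectors, (∀ f ∉ A, f ≠ bar e → C f = 0) ∧ C e * C (bar e) = -ε ∧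
          C e = X e := by
        obtain ⟨⟨C, hC, hCA, hCe⟩, -⟩ := h A hA e heA
        by_cases hCX : C e = X e
        · exact ⟨C, hC, hCA, hCe, hCX⟩
        · refine ⟨-C, N.neg_mem C hC, fun f hf hfe => by simp [hCA f hf hfe], by simp [hCe], ?_⟩
          simp only [Pi.neg_apply]
          generalize C e = a, C (bar e) = b, X e = c at *
          clear * - hCe hCX hε h1
          revert a b c ε; decide
      obtain ⟨C, hC, hCA, hCe, hCX⟩ := this
      have hsep : X (bar e) * C (bar e) = -1 := by
        have := hXε e
        rw [hCX] at hCe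
        generalize X e = a, X (bar e) = b, C (bar e) = c at *
        clear * - this hCe hε h1 h2
        revert a b c ε; decide
      -- Conformal elimination on the full pairs leaves each entry there equal to that of `X` or
      -- `0`, so the sign hypothesis persists and one full pair is lost; yet `Z e = X e` is nonzero.
      obtain ⟨Z, hZ, hZf, hZF, e', he'F, he', hZe'⟩ :=
        N.exists_conformal_elim {f | X f ≠ 0 ∧ X (bar f) ≠ 0} hX hC
          ⟨bar e, ⟨h2, by rwa [hbar e]⟩, hsep⟩
      have hnotfull : ∀ f ∉ A, ¬ (X f ≠ 0 ∧ X (bar f) ≠ 0) → Z f = 0 := by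
        intro f hf hnf
        have hXf : X f = 0 := by
          by_contra h0
          exact hnf ⟨h0, hXA f hf h0⟩
        rw [hZf f (by rw [hXf]; simp), signComp_of_eq hXf, hCA f hf]
        rintro rfl
        exact h2 hXf
      have hZfull : ∀ f, ¬ (X f ≠ 0 ∧ X (bar f) ≠ 0) → Z f * Z (bar f) = 0 := by
        intro f hnf
        by_cases hf : f ∈ A
        · rw [hnotfull (bar f) (fun h => (hA f).1 h hf) (by rw [hbar f]; tauto), mul_zero]
        · rw [hnotfull f hf hnf, zero_mul]
      have hZ0 : Z = 0 := by
        refine ih _ (hk ▸ Set.ncard_lt_ncard ⟨fun f hf => ?_, fun hsub => (hsub he'F).1 hZe'⟩) hZ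
          (fun f => ?_) rfl
        · by_cases hf : X f ≠ 0 ∧ X (bar f) ≠ 0
          · have key : ∀ g, X g ≠ 0 → X (bar g) ≠ 0 → Z g = 0 ∨ Z g = X g := by
              intro g hg1 hg2
              have := hZF g ⟨hg1, hg2⟩
              generalize X g = a, Z g = b at *
              clear * - this hg1
              revert a b; decide
            rcases key f hf.1 hf.2 with h0 | h0
            · simp [h0]
            · rcases key (bar f) hf.2 (by rw [hbar f]; exact hf.1) with h0' | h0'
              · simp [h0']
              · rw [h0, h0']
                exact hXε f
          · simp [hZfull f hf]
        · by_contra hnf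
          rcases mul_eq_zero.1 (hZfull f hnf) with h0 | h0
          · exact hf.1 h0
          · exact hf.2 h0
      have := hZf e (by
        rw [hCX]
        generalize X e = a
        revert a; decide)
      rw [signComp_of_ne h1, hZ0] at this
      exact h1 this.symm
    · push Not at hfull
      obtain ⟨e, he⟩ := Function.ne_iff.1 hX0
      have heA : e ∈ A := .inl ⟨he, hfull e he⟩
      obtain ⟨-, D, hD, hDA, hDe⟩ := h A hA e heA
      have := (hD X hX).eq_zero_of_single (e := e) fun f hfe => by
        by_cases hf : f ∈ A
        · rw [hDA f hf hfe, mul_zero]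
        · have : X f = 0 := by
            by_contra h0
            exact hXA f hf h0 (hfull f h0)
          rw [this, zero_mul]
      rcases mul_eq_zero.1 this with h0 | h0
      · exact he h0
      · rw [h0, zero_mul] at hDe
        exact hε hDe.symm

/-! ### One-point extensions -/

theorem IsOnePointExtension.restrict_mem {M : OrientedMatroid E} {Mhat : OrientedMatroid (Option E)}
    (h : M.IsOnePointExtension Mhat) {X : Option E → SignType} (hX : X ∈ Mhat.vectors)
    (h0 : X none = 0) : (fun e => X (some e)) ∈ M.vectors := by
  rw [← h.1]
  exact ⟨X, hX, h0, rfl⟩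

theorem IsOnePointExtension.exists_lift {M : OrientedMatroid E} {Mhat : OrientedMatroid (Option E)}
    (h : M.IsOnePointExtension Mhat) {C : E → SignType} (hC : C ∈ M.vectors) :
    ∃ X ∈ Mhat.vectors, X none = 0 ∧ ∀ e, X (some e) = C e := by
  rw [← h.1] at hC
  obtain ⟨X, hX, h0, rfl⟩ := hC
  exact ⟨X, hX, h0, fun _ => rfl⟩

/-- Otherwise Farkas gives a covector vanishing on `A` but not at `q`. Lifted fundamental vectors
make it vanish on all of `E`, so `q` would be in the support of no vector. -/
theorem IsOnePointExtension.exists_vector_of_spannedBy [Finite E] {M : OrientedMatroid E}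
    {Mhat : OrientedMatroid (Option E)} (h : M.IsOnePointExtension Mhat) (hA : M.SpannedBy A) :
    ∃ X ∈ Mhat.vectors, (∀ f ∉ A, X (some f) = 0) ∧ X none = 1 := by
  classical
  rcases Mhat.farkas (fun o => o.elim 1 fun _ => 0) (some '' Aᶜ) (g := none) (by simp) (by simp)
    with ⟨X, hX, h1, -, h3⟩ | ⟨Y, hY, -, h2, h3⟩
  · exact ⟨X, hX, fun f hf => h1 _ ⟨f, hf, rfl⟩, h3⟩
  · exfalso
    have hY0 : ∀ f, Y (some f) = 0 := by
      intro f
      have hYA : ∀ f ∈ A, Y (some f) = 0 := fun f hf => h2 (some f) (by simpa using hf) rfl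
      by_cases hf : f ∈ A
      · exact hYA f hf
      · obtain ⟨C, hC, hCA, hCf⟩ := hA.exists_vector hf
        obtain ⟨X, hX, h0, hXC⟩ := h.exists_lift hC
        have := (hY X hX).eq_zero_of_single (e := some f) (by
          rintro (_ | g) hg
          · rw [h0, zero_mul]
          · by_cases hgA : g ∈ A
            · rw [hYA g hgA, mul_zero]
            · rw [hXC, hCA g hgA (by simpa using hg), zero_mul])
        rwa [hXC, hCf, one_mul] at this
    obtain ⟨X, hX, hX0⟩ := h.2
    have := (hY X hX).eq_zero_of_single (e := none) (by
      rintro (_ | g) hg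
      · exact absurd rfl hg
      · rw [hY0, mul_zero])
    rw [h3] at this
    exact hX0 (by simpa using this)

/-- The complementary solutions with prescribed sign on some of the pairs. -/
theorem IsOnePointExtension.exists_complementary [Finite E] {M : OrientedMatroid E}
    {Mhat : OrientedMatroid (Option E)} (h : M.IsOnePointExtension Mhat)
    (hbar : Function.Involutive bar) (hspan : ∀ A, IsTransversal bar A → M.SpannedBy A)
    (hno : ∀ X ∈ M.vectors, (∀ e, X e * X (bar e) ≤ 0) → X = 0) (G : Finset E)
    (hA : IsTransversal bar A) :
    ∃ X ∈ Mhat.vectors, X none = 1 ∧ (∀ e, X (some e) * X (some (bar e)) = 0) ∧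
      (∀ e, e ∈ G ∨ bar e ∈ G → 0 ≤ X (some e)) ∧
      ∀ e ∉ A, e ∉ G → bar e ∉ G → X (some e) = 0 := by
  classical
  induction G using Finset.induction_on generalizing A with
  | empty =>
    obtain ⟨X, hX, hXA, hX1⟩ := h.exists_vector_of_spannedBy (hspan A hA)
    refine ⟨X, hX, hX1, fun e => ?_, by simp, fun e he _ _ => hXA e he⟩
    by_cases he : e ∈ A
    · rw [hXA (bar e) fun h => (hA e).1 h he, mul_zero]
    · rw [hXA e he, zero_mul]
  | insert s G hs ih =>
    by_cases hs' : bar s ∈ G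
    · obtain ⟨X, hX, h1, h2, h3, h4⟩ := ih hA
      refine ⟨X, hX, h1, h2, fun e he => h3 e ?_, fun e he h5 h6 => h4 e he ?_ ?_⟩
      · simp only [Finset.mem_insert] at he
        rcases he with (rfl | he) | (he | he)
        · exact .inr hs'
        · exact .inl he
        · left
          rwa [← hbar e, he]
        · exact .inr he
      · exact fun h => h5 (Finset.mem_insert_of_mem h)
      · exact fun h => h6 (Finset.mem_insert_of_mem h)
    obtain ⟨A₁, hA₁, hsA₁, hA₁A⟩ := exists_transversal_mem hbar hA s
    obtain ⟨A₂, hA₂, hsA₂, hA₂A⟩ := exists_transversal_mem hbar hA (bar s)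
    rw [hbar s] at hA₂A
    obtain ⟨X₁, hX₁, hq₁, hc₁, hG₁, hz₁⟩ := ih hA₁
    obtain ⟨X₂, hX₂, hq₂, hc₂, hG₂, hz₂⟩ := ih hA₂
    have bar_eq : ∀ e, bar e = s → e = bar s := fun e he => by rw [← he, hbar e]
    have hX₁s : X₁ (some (bar s)) = 0 :=
      hz₁ _ (fun h => (hA₁ s).1 h hsA₁) hs' (by rwa [hbar s])
    have hX₂s : X₂ (some s) = 0 := hz₂ _ ((hA₂ s).1 hsA₂) hs hs'
    have finish : ∀ (A' : Set E) (X : Option E → SignType), X ∈ Mhat.vectors → X none = 1 →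
        (∀ e, X (some e) * X (some (bar e)) = 0) →
        (∀ e, e ∈ G ∨ bar e ∈ G → 0 ≤ X (some e)) →
        (∀ e ∉ A', e ∉ G → bar e ∉ G → X (some e) = 0) →
        (∀ f, f ≠ s → f ≠ bar s → (f ∈ A' ↔ f ∈ A)) → 0 ≤ X (some s) → 0 ≤ X (some (bar s)) →
        ∃ X ∈ Mhat.vectors, X none = 1 ∧ (∀ e, X (some e) * X (some (bar e)) = 0) ∧
          (∀ e, e ∈ insert s G ∨ bar e ∈ insert s G → 0 ≤ X (some e)) ∧
          ∀ e ∉ A, e ∉ insert s G → bar e ∉ insert s G → X (some e) = 0 := by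
      intro A' X hX h1 h2 h3 h4 h5 h6 h7
      refine ⟨X, hX, h1, h2, fun e he => ?_, fun e he h8 h9 => ?_⟩
      · simp only [Finset.mem_insert] at he
        rcases he with (rfl | he) | (he | he)
        · exact h6
        · exact h3 e (.inl he)
        · rwa [bar_eq e he]
        · exact h3 e (.inr he)
      · simp only [Finset.mem_insert, not_or] at h8 h9
        refine h4 e (fun h => he ((h5 e h8.1 fun h' => h9.1 ?_).1 h)) h8.2 h9.2
        rw [h', hbar s]
    by_cases hpos₁ : 0 ≤ X₁ (some s)
    · exact finish A₁ X₁ hX₁ hq₁ hc₁ hG₁ hz₁ hA₁A hpos₁ hX₁s.ge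
    by_cases hpos₂ : 0 ≤ X₂ (some (bar s))
    · exact finish A₂ X₂ hX₂ hq₂ hc₂ hG₂ hz₂ (fun f h1 h2 => hA₂A f h2 h1) hX₂s.ge hpos₂
    exfalso
    -- Both choices at the pair of `s` fail, so eliminating `q` leaves a sign-reversing vector of
    -- `M`, nonzero at `s` because only `X₁` is nonzero there.
    obtain ⟨Z, hZ, hZp, hZn, hZq, hZs⟩ := Mhat.elimination X₁ hX₁ (-X₂) (Mhat.neg_mem _ hX₂) none
      hq₁ (by simp [hq₂])
    have hneg₁ : X₁ (some s) = -1 := by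
      generalize X₁ (some s) = a at *
      clear * - hpos₁
      revert a; decide
    have hneg₂ : X₂ (some (bar s)) = -1 := by
      generalize X₂ (some (bar s)) = a at *
      clear * - hpos₂
      revert a; decide
    have hZ0 : ∀ o, X₁ o = 0 → X₂ o = 0 → Z o = 0 := by
      intro o h1 h2
      have hp := hZp o
      have hn := hZn o
      simp only [Pi.neg_apply, h1, h2] at hp hn
      generalize Z o = a at *
      clear * - hp hn
      revert a; decide
    have hZs' : Z (some s) * Z (some (bar s)) ≤ 0 := by
      have hp := hZp (some s)
      have hn := hZn (some (bar s))
      simp only [Pi.neg_apply, hneg₁, hneg₂, hX₁s, hX₂s] at hp hn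
      generalize Z (some s) = a, Z (some (bar s)) = b at *
      clear * - hp hn
      revert a b; decide
    have := hno _ (h.restrict_mem hZ hZq) fun f => by
      by_cases h1 : f = s
      · rwa [h1]
      by_cases h2 : f = bar s
      · rwa [h2, hbar s, mul_comm]
      by_cases hf : f ∈ G ∨ bar f ∈ G
      · have hf' : bar f ∈ G ∨ bar (bar f) ∈ G := by rw [hbar f]; tauto
        have key : ∀ f, f ∈ G ∨ bar f ∈ G →
            (Z (some f) = 1 → X₁ (some f) ≠ 0) ∧ (Z (some f) = -1 → X₂ (some f) ≠ 0) := by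
          intro f hf
          have hp := hZp (some f)
          have hn := hZn (some f)
          have g1 := hG₁ f hf
          have g2 := hG₂ f hf
          simp only [Pi.neg_apply] at hp hn
          generalize X₁ (some f) = a, X₂ (some f) = b, Z (some f) = c at *
          clear * - hp hn g1 g2
          revert a b c; decide
        obtain ⟨k1, k2⟩ := key f hf
        obtain ⟨k3, k4⟩ := key (bar f) hf'
        have c1 := mul_eq_zero.1 (hc₁ f)
        have c2 := mul_eq_zero.1 (hc₂ f)
        have n1 : ¬ (Z (some f) = 1 ∧ Z (some (bar f)) = 1) := fun h => c1.elim (k1 h.1) (k3 h.2)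
        have n2 : ¬ (Z (some f) = -1 ∧ Z (some (bar f)) = -1) := fun h => c2.elim (k2 h.1) (k4 h.2)
        generalize Z (some f) = a, Z (some (bar f)) = b at *
        clear * - n1 n2
        revert a b; decide
      · rw [not_or] at hf
        have h3 : bar f ≠ s := fun h => h2 (bar_eq f h)
        have h4 : bar f ≠ bar s := fun h => h1 (hbar.injective h)
        have key : ∀ g ∉ A, g ≠ s → g ≠ bar s → g ∉ G → bar g ∉ G → Z (some g) = 0 := by
          intro g hg g1 g2 g3 g4
          exact hZ0 _ (hz₁ g (by rwa [hA₁A g g1 g2]) g3 g4) (hz₂ g (by rwa [hA₂A g g2 g1]) g3 g4)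
        by_cases hfA : f ∈ A
        · rw [key (bar f) (fun h => (hA f).1 h hfA) h3 h4 hf.2 (by rw [hbar f]; exact hf.1),
            mul_zero]
        · rw [key f hfA h1 h2 hf.1 hf.2, zero_mul]
    have hZs0 := hZs (some s)
    simp only [Pi.neg_apply, hneg₁, hX₂s] at hZs0
    exact hZs0 (by decide) (congrFun this s)

/-- A nonnegative complementary vector through the new element is unique if `M` has no
sign-reversing vector. -/
theorem IsOnePointExtension.eq_of_complementary {M : OrientedMatroid E}
    {Mhat : OrientedMatroid (Option E)} (h : M.IsOnePointExtension Mhat)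
    (hno : ∀ X ∈ M.vectors, (∀ e, X e * X (bar e) ≤ 0) → X = 0) {X Y : Option E → SignType}
    (hX : X ∈ Mhat.vectors) (hY : Y ∈ Mhat.vectors)
    (hXc : ∀ e, X (some e) * X (some (bar e)) = 0) (hYc : ∀ e, Y (some e) * Y (some (bar e)) = 0)
    (hX0 : ∀ o, 0 ≤ X o) (hY0 : ∀ o, 0 ≤ Y o) (hXq : X none = 1) (hYq : Y none = 1) : X = Y := by
  obtain ⟨Z, hZ, hZp, hZn, hZq, hZs⟩ := Mhat.elimination X hX (-Y) (Mhat.neg_mem _ hY) none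
    hXq (by simp [hYq])
  have key : ∀ o, (Z o = 1 → X o ≠ 0) ∧ (Z o = -1 → Y o ≠ 0) ∧ (Z o = 0 → X o = Y o) := by
    intro o
    have hp := hZp o
    have hn := hZn o
    have hs := hZs o
    have g1 := hX0 o
    have g2 := hY0 o
    simp only [Pi.neg_apply] at hp hn hs
    generalize X o = a, Y o = b, Z o = c at *
    refine ⟨?_, ?_, ?_⟩
    · clear * - hp g1 g2
      revert a b c; decide
    · clear * - hn g1 g2
      revert a b c; decide
    · clear * - hs g1 g2
      revert a b c; decide
  -- Positive entries of `Z` come from `X` and negative ones from `Y`; each is complementary, so no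
  -- pair carries equal nonzero signs.
  have hZ0 := hno _ (h.restrict_mem hZ hZq) fun f => by
    obtain ⟨k1, k2, -⟩ := key (some f)
    obtain ⟨k3, k4, -⟩ := key (some (bar f))
    have c1 := mul_eq_zero.1 (hXc f)
    have c2 := mul_eq_zero.1 (hYc f)
    have n1 : ¬ (Z (some f) = 1 ∧ Z (some (bar f)) = 1) := fun h => c1.elim (k1 h.1) (k3 h.2)
    have n2 : ¬ (Z (some f) = -1 ∧ Z (some (bar f)) = -1) := fun h => c2.elim (k2 h.1) (k4 h.2)
    generalize Z (some f) = a, Z (some (bar f)) = b at *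
    clear * - n1 n2
    revert a b; decide
  funext o
  refine (key o).2.2 ?_
  cases o with
  | none => exact hZq
  | some e => exact congrFun hZ0 e

end OrientedMatroid

/-! ### From unique complementary circuits to fundamental signs -/

namespace OrientedMatroid

variable {E : Type*} {bar : E → E} {A S : Set E}

/-- Uniqueness of the complementary solutions for all one-point extensions forces the sign
of a fundamental vector at a pair. -/
theorem fundamental_eq_one_of_existsUnique [Finite E] {M : OrientedMatroid E}
    (hbar : Function.Involutive bar)
    (hc : ∀ Mhat : OrientedMatroid (Option E), M.IsOnePointExtension Mhat →
      ∃! C : Option E → SignType, Mhat.IsCircuit C ∧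
        (∀ e, C (some e) * C (some (bar e)) = 0) ∧ (∀ x, 0 ≤ C x) ∧ C none = 1)
    (hA : IsTransversal bar A) (hind : M.dual.SpannedBy Aᶜ) {e : E} (he : e ∈ A)
    {C : E → SignType} (hC : C ∈ M.vectors) (hCA : ∀ f ∉ A, f ≠ bar e → C f = 0)
    (hCe : C (bar e) = 1) : C e = 1 := by
  classical
  have := Fintype.ofFinite E
  by_contra hne
  let l : List E := (Finset.univ.filter fun f => f ∈ A ∧ f ≠ e).toList
  have hl : ∀ {f}, f ∈ l ↔ f ∈ A ∧ f ≠ e := by simp [l]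
  let s : E → SignType := fun f => if f = e then 1 else -1
  have hs : ∀ a, s a ≠ 0 := fun a => by
    by_cases h : a = e <;> simp [s, h]
  have hsl : ∀ a ∈ l, s a = -1 := fun a ha => by simp [s, (hl.1 ha).2]
  -- Existence is used for the perturbed extension `l ++ [e]`, uniqueness for the unperturbed
  -- extension `l`.
  obtain ⟨X, ⟨⟨hX, -⟩, hXc, hX0, hXq⟩, -⟩ :=
    hc _ (isOnePointExtension_lexExtension (s := s) (l := l ++ [e]) M hs)
  obtain ⟨P, ⟨-, huniq⟩⟩ := hc _ (isOnePointExtension_lexExtension (s := s) (l := l) M hs)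
  -- Undoing the perturbation: a covector that is `+` at `q` before appending `e` remains a covector
  -- afterwards, so the Farkas alternative contradicts `hX`.
  have hX' : ∃ X' ∈ (M.lexExtension s l hs).vectors, Conforms X' X ∧ X' none = 1 := by
    rcases (M.lexExtension s l hs).farkas X {o | X o = 0} (g := none) (by simp [hXq])
      (by simp [hXq]) with ⟨X', hX', h1, h2, h3⟩ | ⟨Y, hY, h1, -, h3⟩
    · refine ⟨X', hX', fun o ho => ?_, h3.trans hXq⟩
      have g1 := h1 o
      have g2 := h2 o
      simp only [Set.mem_ofPred_eq] at g1 g2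
      generalize X o = a, X' o = b at *
      clear * - g1 g2 ho
      revert a b; decide
    · exfalso
      have hY2 : Y ∈ (M.lexExtension s (l ++ [e]) hs).covectors := by
        rw [mem_covectors_lexExtension] at hY ⊢
        obtain ⟨hY, hYa⟩ := hY
        refine ⟨hY, ?_⟩
        rw [h3, hXq] at hYa ⊢
        obtain ⟨U, hU, hUY, hUs⟩ := hYa.1 (by decide)
        refine ⟨fun _ => ⟨U, hU, hUY, ?_⟩, fun h => absurd h (by decide)⟩
        rw [lexSign_append _ (by rw [hUs]; decide), hUs]
      have := (hY2 X hX).eq_zero_of_nonneg (fun o => by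
        by_cases h0 : X o = 0
        · simp [h0]
        · exact h1 o h0) none
      rw [h3, hXq] at this
      exact absurd this (by decide)
  obtain ⟨X', hX', hX'X, hX'q⟩ := hX'
  obtain ⟨C₁, hC₁, hC₁X', hC₁q⟩ := exists_circuit_conforms _ hX' (g := none) (by simp [hX'q])
  obtain ⟨C₂, hC₂, hC₂P, hC₂q⟩ := exists_circuit_conforms _
    (lexExtension_vector_mem (l := l) M hs) (g := none) (by simp)
  have hC₁X := hC₁X'.trans hX'X
  have hC₂0 : ∀ f, f ∉ A ∨ f = e → C₂ (some f) = 0 := fun f hf => by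
    refine hC₂P.eq_zero ?_
    have : f ∉ l := fun h => by
      have := hl.1 h
      tauto
    simp [this]
  have hC₁₂ : C₁ = C₂ := by
    refine (huniq C₁ ⟨hC₁, fun f => ?_, fun o => ?_, hC₁q.trans hX'q⟩).trans
      (huniq C₂ ⟨hC₂, fun f => ?_, fun o => ?_, hC₂q⟩).symm
    · rcases mul_eq_zero.1 (hXc f) with h | h
      · rw [hC₁X.eq_zero h, zero_mul]
      · rw [hC₁X.eq_zero h, mul_zero]
    · by_cases h0 : C₁ o = 0
      · rw [h0]
      · rw [hC₁X o h0]
        exact hX0 o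
    · by_cases hf : f ∈ A
      · rw [hC₂0 (bar f) (.inl fun h => (hA f).1 h hf), mul_zero]
      · rw [hC₂0 f (.inl hf), zero_mul]
    · by_cases h0 : C₂ o = 0
      · rw [h0]
      · rw [hC₂P o h0]
        cases o with
        | none => simp
        | some a =>
          by_cases ha : a ∈ l
          · simp [ha, hsl a ha]
          · simp [ha]
  -- The fundamental covector at `f` is `-1` at `q`, so `C₂` is positive at `f`; hence so is `X`,
  -- and complementarity clears `bar f`.
  have hXF : ∀ f ∈ A, f ≠ e → X (some (bar f)) = 0 := by
    intro f hf hfe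
    obtain ⟨D, hD, hDA, hDf⟩ := SpannedBy.exists_covector hind hf
    have hsign : lexSign s l D = -1 := by
      have h1 : lexSign s l D ≠ 1 := lexSign_ne_of_forall (by decide) fun a ha => by
        by_cases haf : a = f
        · rw [haf, hDf, hsl f (haf ▸ ha)]
          decide
        · rw [hDA a (hl.1 ha).1 haf, mul_zero]
          decide
      have h0 : lexSign s l D ≠ 0 := fun h0 => by
        have := (lexSign_eq_zero hs).1 h0 f (hl.2 ⟨hf, hfe⟩)
        rw [hDf] at this
        exact absurd this (by decide)
      exact (SignType.ne_zero_cases h0).resolve_left h1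
    have hmem : (fun o => o.elim (-1) D : Option E → SignType) ∈
        (M.lexExtension s l hs).covectors := by
      refine mem_covectors_lexExtension.2 ⟨hD, ?_⟩
      have := lexAdmissible_lexSign (N := M.dual) (s := s) (l := l) hD (by rw [hsign]; decide)
      rwa [hsign] at this
    have := (hmem C₂ hC₂.1).eq_neg_of_pair (e := some f) (e' := none) (by
      rintro (_ | a) h1 h2
      · exact absurd rfl h2
      · by_cases ha : a ∈ A
        · have : D a = 0 := hDA a ha (by simpa using h1)
          simp [this]
        · rw [hC₂0 a (.inl ha), zero_mul])
    simp only [Option.elim_some, Option.elim_none, hDf, hC₂q, mul_one, one_mul, neg_neg] at this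
    have hXf := hC₁X (some f) (by rw [hC₁₂, this]; decide)
    have h0 := mul_eq_zero.1 (hXc f)
    rw [← hXf, hC₁₂, this] at h0
    exact h0.resolve_left (by decide)
  obtain ⟨D, hD, hDA, hDe⟩ := SpannedBy.exists_covector hind he
  have hDl : ∀ a ∈ l, D a = 0 := fun a ha => hDA a (hl.1 ha).1 (hl.1 ha).2
  have hsign : lexSign s (l ++ [e]) D = 1 := by
    rw [lexSign_append_of_forall_eq_zero _ hDl]
    simp [lexSign, hDe, s]
  have hmem : (fun o => o.elim 1 D : Option E → SignType) ∈
      (M.lexExtension s (l ++ [e]) hs).covectors := by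
    refine mem_covectors_lexExtension.2 ⟨hD, ?_⟩
    have := lexAdmissible_lexSign (N := M.dual) (s := s) (l := l ++ [e]) hD
      (by rw [hsign]; decide)
    rwa [hsign] at this
  have hDbar : 0 ≤ D (bar e) := by
    have := (hD C hC).eq_neg_of_pair (e := e) (e' := bar e) fun f h1 h2 => by
      by_cases hf : f ∈ A
      · rw [hDA f hf h1, mul_zero]
      · rw [hCA f hf h2, zero_mul]
    rw [hDe, hCe] at this
    generalize C e = a, D (bar e) = b at *
    clear * - this hne
    revert a b; decide
  -- Off `q, e, bar e`, either `D` or `X` vanishes; the products at `e` and `bar e` are nonnegative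
  -- and the one at `q` is positive.
  have := (hmem X hX).eq_zero_of_nonneg (by
    rintro (_ | g)
    · simp [hXq]
    · have hXg := hX0 (some g)
      simp only [Option.elim_some]
      by_cases hge : g = e
      · rw [hge, hDe, mul_one]
        exact hX0 _
      by_cases hge' : g = bar e
      · rw [hge']
        have := hX0 (some (bar e))
        generalize X (some (bar e)) = a, D (bar e) = b at *
        clear * - this hDbar
        revert a b; decide
      by_cases hg : g ∈ A
      · rw [hDA g hg hge, mul_zero]
      · have := hXF (bar g) ((hA g).2 hg) fun h => hge' (by rw [← h, hbar g])
        rw [hbar g] at this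
        rw [this, zero_mul]) none
  simp [hXq] at this

theorem pairCondition_of_existsUnique [Finite E] {M : OrientedMatroid E}
    (hbar : Function.Involutive bar) (hS : IsTransversal bar S) (hspan : M.SpannedBy S)
    (hind : M.dual.SpannedBy Sᶜ)
    (hc : ∀ Mhat : OrientedMatroid (Option E), M.IsOnePointExtension Mhat →
      ∃! C : Option E → SignType, Mhat.IsCircuit C ∧
        (∀ e, C (some e) * C (some (bar e)) = 0) ∧ (∀ x, 0 ≤ C x) ∧ C none = 1) :
    M.PairCondition bar (-1) := by
  have key : ∀ A, IsTransversal bar A → M.SpannedBy A → M.dual.SpannedBy Aᶜ → ∀ e ∈ A,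
      ∃ C ∈ M.vectors, (∀ f ∉ A, f ≠ bar e → C f = 0) ∧ C e = 1 ∧ C (bar e) = 1 := by
    intro A hA hspan hind e he
    obtain ⟨C, hC, hCA, hCe⟩ := hspan.exists_vector (g := bar e) (fun h => (hA e).1 h he)
    exact ⟨C, hC, hCA, fundamental_eq_one_of_existsUnique hbar hc hA hind he hC hCA hCe, hCe⟩
  have all : ∀ A, IsTransversal bar A → M.SpannedBy A ∧ M.dual.SpannedBy Aᶜ := by
    intro A hA
    refine transversal_induction (P := fun A => M.SpannedBy A ∧ M.dual.SpannedBy Aᶜ) hbar hS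
      ⟨hspan, hind⟩ (fun A hA ⟨hspan, hind⟩ e he => ?_) hA
    obtain ⟨C, hC, hCA, hCe, hCe'⟩ := key A hA hspan hind e he
    refine ⟨hspan.switch hC hCA (by rw [hCe]; decide), ?_⟩
    rw [compl_switch hA hbar]
    obtain ⟨D, hD, hDA, hDe⟩ := SpannedBy.exists_covector hind he
    refine hind.switch (C := D) hD (fun f hf hfe => ?_) ?_
    · rw [hbar e] at hfe
      exact hDA f (by simpa using hf) hfe
    · have := (hD C hC).eq_neg_of_pair (e := e) (e' := bar e) fun f h1 h2 => by
        by_cases hf : f ∈ A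
        · rw [hDA f hf h1, mul_zero]
        · rw [hCA f hf h2, zero_mul]
      intro h0
      rw [hDe, hCe, h0, mul_zero] at this
      exact absurd this (by decide)
  refine pairCondition_of_spannedBy (fun A hA e he => ?_)
    (fun A hA e he => SpannedBy.exists_covector (all A hA).2 he) (by decide)
  obtain ⟨C, hC, hCA, hCe, hCe'⟩ := key A hA (all A hA).1 (all A hA).2 e he
  exact ⟨C, hC, hCA, by rw [hCe, hCe']; decide⟩

/-! ### Circuits, vectors of full support, and bases -/

/-- A property of sign vectors that passes to conforming vectors holds for no circuit if and only
if it holds for no nonzero vector. -/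
theorem not_exists_circuit_iff [Finite E] {M : OrientedMatroid E} {Q : (E → SignType) → Prop}
    (hQ : ∀ X Y, Conforms X Y → Q Y → Q X) :
    (¬ ∃ C, M.IsCircuit C ∧ Q C) ↔ ∀ X ∈ M.vectors, Q X → X = 0 := by
  constructor
  · intro h X hX hXQ
    by_contra h0
    obtain ⟨C, hC, hCX⟩ := M.exists_circuit_conforms_of_ne_zero hX h0
    exact h ⟨C, hC, hQ C X hCX hXQ⟩
  · rintro h ⟨C, hC, hCQ⟩
    exact hC.2.1 (h C hC.1 hCQ)

/-- If `Q` passes to conforming vectors and is witnessed by vectors of full support, then it holds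
for no nonzero vector if and only if the sign vectors of full support that have it are
covectors. -/
theorem forall_eq_zero_iff_forall_mem_covectors {M : OrientedMatroid E}
    {Q : (E → SignType) → Prop} (hQ : ∀ X Y, Conforms X Y → Q Y → Q X)
    (hQ' : ∀ X, Q X → ∃ Y, Conforms X Y ∧ Q Y ∧ Function.support Y = Set.univ) :
    (∀ X ∈ M.vectors, Q X → X = 0) ↔
      ∀ Y, Q Y ∧ Function.support Y = Set.univ → Y ∈ M.covectors := by
  constructor
  · rintro h Y ⟨hY, hYu⟩
    refine M.mem_covectors_of_nonneg fun X hX hpos => ?_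
    have hXY : Conforms X Y := fun f hf => by
      have h1 := hpos f
      have h2 : f ∈ Function.support Y := hYu ▸ Set.mem_univ f
      rw [Function.mem_support] at h2
      generalize X f = a, Y f = b at *
      clear * - h1 h2 hf
      revert a b; decide
    simp [h X hX (hQ X Y hXY hY)]
  · intro h X hX hXQ
    obtain ⟨Y, hXY, hY, hYu⟩ := hQ' X hXQ
    funext f
    by_contra hf
    have := (h Y ⟨hY, hYu⟩ X hX).eq_zero_of_nonneg (fun g => by
      by_cases h0 : X g = 0
      · simp [h0]
      · rw [← hXY g h0]
        generalize X g = a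
        revert a; decide) f
    rw [← hXY f hf] at this
    exact hf (by simpa using this)

theorem IsBasis.eq_zero [Finite E] {M : OrientedMatroid E} {B : Set E} (hB : M.IsBasis B)
    {X : E → SignType} (hX : X ∈ M.vectors) (h : ∀ e ∉ B, X e = 0) : X = 0 := by
  by_contra h0
  obtain ⟨C, hC, hCX⟩ := M.exists_circuit_conforms_of_ne_zero hX h0
  refine hB.1 ⟨C, hC, fun e he => ?_⟩
  by_contra heB
  exact he (hCX.eq_zero (h e heB))

/-- Maximality gives a circuit in `B ∪ {e}` through `e`; a covector vanishing on `B` can meet it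
only in `e`. -/
theorem IsBasis.spannedBy [Finite E] {M : OrientedMatroid E} {B : Set E} (hB : M.IsBasis B) :
    M.SpannedBy B := by
  intro Y hY hYB
  funext e
  by_cases he : e ∈ B
  · exact hYB e he
  have : ∃ C, M.IsCircuit C ∧ Function.support C ⊆ insert e B := by
    by_contra hno
    exact he (hB.2 hno (Set.subset_insert e B) (Set.mem_insert e B))
  obtain ⟨C, hC, hCe⟩ := this
  have hCe0 : C e ≠ 0 := by
    intro h0
    refine hC.2.1 (hB.eq_zero hC.1 fun f hf => ?_)
    by_contra hne
    rcases hCe hne with rfl | h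
    · exact hne h0
    · exact hf h
  have := (hY C hC.1).eq_zero_of_single (e := e) fun f hfe => by
    by_cases hf : f ∈ B
    · rw [hYB f hf, mul_zero]
    · have : C f = 0 := by
        by_contra hne
        rcases hCe hne with h | h
        · exact hfe h
        · exact hf h
      rw [this, zero_mul]
  exact (mul_eq_zero.1 this).resolve_left hCe0

end OrientedMatroid

/-! ### Sign-reversing and sign-preserving vectors on the paired ground set -/

namespace Complementation

variable {E : Type*} {n : ℕ} (K : Complementation E n)

theorem finite (K : Complementation E n) : Finite E := by
  have hS : K.S.Finite := Set.finite_of_encard_eq_coe K.encard_S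
  have hT : K.T.Finite := Set.finite_of_encard_eq_coe K.encard_T
  have h := hS.union hT
  have hU : K.S ∪ K.T = Set.univ := by
    simpa using K.isCompl.sup_eq_top
  rw [hU] at h
  exact Set.finite_univ_iff.1 h

theorem isTransversal_S : IsTransversal K.bar K.S := by
  have hbar : Function.Involutive K.bar := K.bar_bar
  have hT : K.S = K.Tᶜ := K.isCompl.eq_compl
  have himage : K.bar '' K.S = K.T := by
    refine (Set.finite_of_encard_eq_coe K.encard_T).eq_of_subset_of_encard_le'
      (Set.image_subset_iff.2 K.bar_mem) ?_
    rw [hbar.injective.encard_image, K.encard_S, K.encard_T]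
  intro e
  constructor
  · intro h he
    have := K.bar_mem e he
    rw [hT] at h
    exact h this
  · intro he
    have : e ∈ K.T := by
      rw [hT] at he
      simpa using he
    rw [← himage] at this
    obtain ⟨f, hf, rfl⟩ := this
    rwa [K.bar_bar]

theorem signReversing_iff {X : E → SignType} :
    K.SignReversing X ↔ ∀ e, X e * X (K.bar e) ≤ 0 := by
  refine ⟨fun h e => ?_, fun h e _ => h e⟩
  by_cases he : e ∈ K.S
  · exact h e he
  · have := h _ ((K.isTransversal_S e).2 he)
    rwa [K.bar_bar, mul_comm] at this

theorem SignReversing.of_conforms {K : Complementation E n} {X Y : E → SignType}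
    (h : Conforms X Y) (hY : K.SignReversing Y) : K.SignReversing X := by
  intro e he
  have h1 := h e
  have h2 := h (K.bar e)
  have h3 := hY e he
  generalize X e = a, X (K.bar e) = b at *
  by_cases ha : a = 0
  · simp [ha]
  by_cases hb : b = 0
  · simp [hb]
  rwa [h1 ha, h2 hb]

theorem SignPreserving.of_conforms {K : Complementation E n} {X Y : E → SignType}
    (h : Conforms X Y) (hY : K.SignPreserving Y) : K.SignPreserving X := by
  intro e
  have h1 := h e
  have h2 := h (K.bar e)
  have h3 := hY e
  generalize X e = a, X (K.bar e) = b at *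
  by_cases ha : a = 0
  · simp [ha]
  by_cases hb : b = 0
  · simp [hb]
  rwa [h1 ha, h2 hb]

open Classical in
/-- Fill the zeros of `X` from the signs on the complements, multiplied by `t`, and by `1` and `t`
on pairs of zeros. -/
theorem exists_full_support (t : SignType) (ht : t ≠ 0) {X : E → SignType}
    (hX : ∀ e, 0 ≤ t * (X e * X (K.bar e))) :
    ∃ Y, Conforms X Y ∧ (∀ e, 0 ≤ t * (Y e * Y (K.bar e))) ∧
      Function.support Y = Set.univ := by
  let Y : E → SignType := fun e =>
    if X e ≠ 0 then X e else if X (K.bar e) ≠ 0 then t * X (K.bar e) else if e ∈ K.S then 1 else t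
  refine ⟨Y, fun f hf => by simp [Y, hf], fun e => ?_, ?_⟩
  · have h1 := hX e
    have h2 := K.isTransversal_S e
    simp only [Y, K.bar_bar, h2]
    by_cases he : e ∈ K.S <;> simp only [he, not_true, not_false_eq_true, if_true, if_false] <;>
    · generalize X e = a, X (K.bar e) = b at *
      clear * - h1 ht
      revert a b t; decide
  · refine Set.eq_univ_of_forall fun e => ?_
    rw [Function.mem_support]
    simp only [Y]
    split_ifs with h1 h2 h3
    · exact h1
    · simp [ht, h2]
    · decide
    · exact ht

end Complementation

/-! ### The equivalences -/

theorem theorem3p3 {E : Type*} {n : ℕ} (K : Complementation E n) (M : OrientedMatroid E)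
    (hS : M.IsBasis K.S) :
    List.TFAE [
      ¬ ∃ C, M.IsCircuit C ∧ K.SignReversing C,
      ¬ ∃ D, M.IsCocircuit D ∧ K.SignPreserving D,
      ∀ X : E → SignType, K.TotallySignPreserving X → X ∈ M.vectors,
      ∀ Y : E → SignType, K.TotallySignReversing Y → Y ∈ M.covectors,
      ∀ Mhat : OrientedMatroid (Option E), M.IsOnePointExtension Mhat →
        ∃! C : Option E → SignType, Mhat.IsCircuit C ∧ K.IsComplementary C ∧
          (∀ x, 0 ≤ C x) ∧ C none = 1] := by
  have := K.finite
  have hbar : Function.Involutive K.bar := K.bar_bar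
  have hT := K.isTransversal_S
  have hspan := hS.spannedBy
  have hind : M.dual.SpannedBy K.Sᶜ := by
    intro X hX h
    rw [OrientedMatroid.dual_covectors] at hX
    exact hS.eq_zero hX h
  have rev : ∀ X : E → SignType,
      K.SignReversing X ↔ ∀ e, 0 ≤ (-1 : SignType) * (X e * X (K.bar e)) := by
    intro X
    rw [K.signReversing_iff]
    refine forall_congr' fun e => ?_
    generalize X e * X (K.bar e) = a
    revert a; decide
  have pres : ∀ X : E → SignType,
      K.SignPreserving X ↔ ∀ e, 0 ≤ (1 : SignType) * (X e * X (K.bar e)) := by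
    intro X
    simp [Complementation.SignPreserving]
  have iff_rev := OrientedMatroid.not_exists_circuit_iff (M := M)
    fun X Y => Complementation.SignReversing.of_conforms (K := K) (X := X) (Y := Y)
  have iff_pres := OrientedMatroid.not_exists_circuit_iff (M := M.dual)
    fun X Y => Complementation.SignPreserving.of_conforms (K := K) (X := X) (Y := Y)
  have full_rev := OrientedMatroid.forall_eq_zero_iff_forall_mem_covectors (M := M)
    (fun X Y => Complementation.SignReversing.of_conforms (K := K) (X := X) (Y := Y))
    (fun X hX => by
      obtain ⟨Y, h1, h2, h3⟩ := K.exists_full_support (-1) (by decide) ((rev X).1 hX)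
      exact ⟨Y, h1, (rev Y).2 h2, h3⟩)
  have full_pres := OrientedMatroid.forall_eq_zero_iff_forall_mem_covectors (M := M.dual)
    (fun X Y => Complementation.SignPreserving.of_conforms (K := K) (X := X) (Y := Y))
    (fun X hX => by
      obtain ⟨Y, h1, h2, h3⟩ := K.exists_full_support 1 (by decide) ((pres X).1 hX)
      exact ⟨Y, h1, (pres Y).2 h2, h3⟩)
  rw [OrientedMatroid.dual_covectors] at full_pres
  have pair_rev : (∀ X ∈ M.vectors, K.SignReversing X → X = 0) ↔ M.PairCondition K.bar (-1) := by
    constructor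
    · intro h
      exact (OrientedMatroid.pairCondition_of_no_vector hbar hT hspan (by decide)
        fun X hX hXr => h X hX ((rev X).2 hXr)).2
    · intro h X hX hXr
      exact h.eq_zero hbar hT (by decide) hX ((rev X).1 hXr)
  have pair_pres : (∀ X ∈ M.dual.vectors, K.SignPreserving X → X = 0) ↔
      M.dual.PairCondition K.bar 1 := by
    constructor
    · intro h
      exact (OrientedMatroid.pairCondition_of_no_vector hbar hT.compl hind (by decide)
        fun X hX hXr => h X hX ((pres X).2 hXr)).2
    · intro h X hX hXr
      exact h.eq_zero hbar hT (by decide) hX ((pres X).1 hXr)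
  tfae_have 1 ↔ 4 := iff_rev.trans full_rev
  tfae_have 2 ↔ 3 := iff_pres.trans full_pres
  tfae_have 1 ↔ 2 := by
    refine (iff_rev.trans (pair_rev.trans ?_)).trans (iff_pres.trans pair_pres).symm
    refine ⟨fun h => h.dual hbar, fun h => ?_⟩
    have := h.dual hbar
    rwa [M.dual_dual] at this
  tfae_have 1 → 5 := by
    intro h Mhat hM
    rw [iff_rev] at h
    have hno : ∀ X ∈ M.vectors, (∀ e, X e * X (K.bar e) ≤ 0) → X = 0 :=
      fun X hX hXr => h X hX (K.signReversing_iff.2 hXr)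
    have hspan' := (OrientedMatroid.pairCondition_of_no_vector hbar hT hspan (ε := -1) (by decide)
        fun X hX hXr => h X hX ((rev X).2 hXr)).1
    have := Fintype.ofFinite E
    -- With every pair in `G`, the solution is nonnegative throughout; a conforming circuit through
    -- `q` inherits all its properties.
    obtain ⟨X, hX, hXq, hXc, hX0, -⟩ := hM.exists_complementary hbar hspan' hno Finset.univ hT
    have hX0 : ∀ o, 0 ≤ X o := by
      rintro (_ | e)
      · rw [hXq]; decide
      · exact hX0 e (.inl (Finset.mem_univ e))
    obtain ⟨C, hC, hCX, hCq⟩ := Mhat.exists_circuit_conforms hX (g := none) (by rw [hXq]; decide)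
    have hCc : K.IsComplementary C := by
      intro e
      rcases mul_eq_zero.1 (hXc e) with h | h
      · rw [hCX.eq_zero h, zero_mul]
      · rw [hCX.eq_zero h, mul_zero]
    have hC0 : ∀ o, 0 ≤ C o := by
      intro o
      by_cases h0 : C o = 0
      · rw [h0]
      · rw [hCX o h0]
        exact hX0 o
    refine ⟨C, ⟨hC, hCc, hC0, hCq.trans hXq⟩, fun C' hC' => ?_⟩
    exact hM.eq_of_complementary hno hC'.1.1 hC.1 hC'.2.1 hCc hC'.2.2.1 hC0 hC'.2.2.2
      (hCq.trans hXq)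
  tfae_have 5 → 1 := by
    intro h
    rw [iff_rev, pair_rev]
    exact OrientedMatroid.pairCondition_of_existsUnique hbar hT hspan hind h
  tfae_finish
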